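/- Let $\Omega\subseteq\mathbb{R}^n$ be open, $1\le p\le\infty$, let $L^p(\Omega)$ be the real Lebesgue space, and let $A:L^p(\Omega)\to L^p(\Omega)$ be a bounded linear operator. Let $\alpha:\Omega\to(0,1]$ be Lebesgue measurable, and suppose that there are $m\ge 1$, subsets $\Omega_1,\dots,\Omega_m$ with $\bigcup_{j=1}^m\Omega_j=\Omega$, and numbers $\alpha_1,\dots,\alpha_m\in(0,1]$ such that $\alpha(x)=\alpha_j$ for every $x\in\Omega_j$, $j=1,\dots,m$. Assume the commutation condition: for each $\phi\in L^p(\Omega)$ and every $s\ge0$, $$\frac{s^{\alpha(x)}}{\Gamma(\alpha(x)+1)}\,A\phi(x)=A\left(\frac{s^{\alpha(\cdot)}}{\Gamma(\alpha(\cdot)+1)}\,\phi\right)(x)\qquad\text{for almost every }x\in\Omega .$$ For $\phi\in L^p(\Omega)$, a solution of the Cauchy problem $$cD_t^{\alpha(x)}u(t,x)=Au(t,x),\qquad u(0,x)=\phi(x)$$ is a function $u\in C([0,\infty);L^p(\Omega))$ with $u(0)=\phi$ such that, for every $t\ge 0$, $\frac{d}{dt}\,J_t^{1-\alpha(x)}\big[u(t,x)-u(0,x)\big]=Au(t,x)$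 in $L^p(\Omega)$. Here $\frac{d}{dt}$ is the derivative of $L^p(\Omega)$-valued functions on $[0,\infty)$ (one-sided at $t=0$), and $J_t^{\beta(x)}$ is the Riemann-Liouville fractional integral, $J_t^{\beta(x)}v(t,x)=\frac1{\Gamma(\beta(x))}\int_0^t(t-s)^{\beta(x)-1}v(s,x)\,ds$ if $\beta(x)>0$ and $J_t^{\beta(x)}v(t,x)=v(t,x)$ if $\beta(x)=0$, computed for a jointly measurable representative. Then for each $\phi\in L^p(\Omega)$ this problem has exactly one solution $u(\cdot;\phi)$; the formula $S(t)\phi:=u(t;\phi)$ defines, for each $t\ge0$, a bounded linear operator $S(t)$ on $L^p(\Omega)$; and there is a constant $M>0$ such that $$\|S(t)\|\le M e^{\Lambda t}\quad\text{for all }t\ge0,\qquad\text{where }\Lambda=\max_{1\le j\le m}\|A\|^{1/\alpha_j}.$$ Here $\|\cdot\|$ denotes the operator norm on $\mathcal{L}(L^p(\Omega))$. -/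

import Mathlib

open MeasureTheory Set

/-- The real Lebesgue space `L^p(Ω)`, for `Ω ⊆ ℝⁿ` with Lebesgue measure. -/
abbrev LpOn {n : ℕ} (Ω : Set (EuclideanSpace ℝ (Fin n))) (p : ENNReal) : Type :=
  Lp ℝ p (volume.restrict Ω)

/-- The Riemann-Liouville fractional integral of variable order,
`J_t^{β(x)} w(t, x) = 1 / Γ(β(x)) * ∫_0^t (t - s)^(β(x) - 1) w(s, x) ds` where `β(x) > 0`,
and `J_t^{β(x)} w(t, x) = w(t, x)` where `β(x) = 0`. -/
noncomputable def rlIntegral {X : Type*} (β : X → ℝ) (w : ℝ → X → ℝ) (t : ℝ) (x : X) : ℝ :=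
  open Classical in
  if β x = 0 then w t x
  else 1 / Real.Gamma (β x) * ∫ s in (0 : ℝ)..t, (t - s) ^ (β x - 1) * w s x

/-- `HasCaputoDeriv α φ ψ`: the Caputo fractional derivative of order `α(x)` of the curve
`φ : [0, ∞) → L^p(Ω)` exists at every `t ≥ 0` and equals `ψ t`, that is,
`d/dt J_t^{1 - α(x)} [φ(t, x) - φ(0, x)] = ψ(t, x)`.
Here `w` is a jointly measurable function of `(t, x)` representing `φ`, through which the fractional
integral is computed pointwise; `G t` is the class of `J_t^{1 - α(x)} [φ(t, x) - φ(0, x)]` in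
`L^p(Ω)`; and `d/dt` is the derivative of curves in `L^p(Ω)`, one-sided at `t = 0`. -/
def HasCaputoDeriv {n : ℕ} {Ω : Set (EuclideanSpace ℝ (Fin n))} {p : ENNReal} [Fact (1 ≤ p)]
    (α : EuclideanSpace ℝ (Fin n) → ℝ) (φ ψ : ℝ → LpOn Ω p) : Prop :=
  ∃ w : ℝ → EuclideanSpace ℝ (Fin n) → ℝ,
    Measurable (Function.uncurry w) ∧
    (∀ t : ℝ, 0 ≤ t → ∀ᵐ x ∂(volume.restrict Ω), φ t x = w t x) ∧
    ∃ G : ℝ → LpOn Ω p,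
      (∀ t : ℝ, 0 ≤ t → ∀ᵐ x ∂(volume.restrict Ω),
        G t x = rlIntegral (fun y => 1 - α y) (fun s y => w s y - w 0 y) t x) ∧
      ∀ t : ℝ, 0 ≤ t → HasDerivWithinAt G (ψ t) (Ici 0) t

/-- `u ∈ C([0, ∞); L^p(Ω))` is a solution on `[0, ∞) × Ω` of the Cauchy problem
`cD_t^{α(x)} u(t, x) = A u(t, x)`, `u(0, x) = u₀(x)`. Only the values `u t` with `t ≥ 0` matter. -/
structure IsCauchySolution {n : ℕ} {Ω : Set (EuclideanSpace ℝ (Fin n))} {p : ENNReal}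
    [Fact (1 ≤ p)] (α : EuclideanSpace ℝ (Fin n) → ℝ) (A : LpOn Ω p →L[ℝ] LpOn Ω p)
    (u₀ : LpOn Ω p) (u : ℝ → LpOn Ω p) : Prop where
  continuousOn : ContinuousOn u (Ici 0)
  equation : HasCaputoDeriv α u (fun t => A (u t))
  initial : u 0 = u₀

/-- `{S(t) : t ≥ 0}` is the family of bounded operators defined by the Cauchy problem:
for each `φ ∈ L^p(Ω)` the problem with initial value `φ` has exactly one solution, namely
`t ↦ S(t) φ` (two curves are identified when they agree on `[0, ∞)`). -/
def IsSolutionOperatorFamily {n : ℕ} {Ω : Set (EuclideanSpace ℝ (Fin n))} {p : ENNReal}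
    [Fact (1 ≤ p)] (α : EuclideanSpace ℝ (Fin n) → ℝ) (A : LpOn Ω p →L[ℝ] LpOn Ω p)
    (S : ℝ → (LpOn Ω p →L[ℝ] LpOn Ω p)) : Prop :=
  ∀ φ : LpOn Ω p, IsCauchySolution α A φ (fun t => S t φ) ∧
    ∀ u : ℝ → LpOn Ω p, IsCauchySolution α A φ u → ∀ t : ℝ, 0 ≤ t → u t = S t φ

/-- The commutation condition: for each `φ ∈ L^p(Ω)`, every `s ≥ 0` and almost every `x ∈ Ω`,
`(s^α(x) / Γ(α(x) + 1)) Aφ(x) = A((s^α / Γ(α + 1)) φ)(x)`.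
Here `ψ` is the element of `L^p(Ω)` given by the product `(s^α / Γ(α + 1)) φ`. -/
def CommutesWithOrder {n : ℕ} {Ω : Set (EuclideanSpace ℝ (Fin n))} {p : ENNReal} [Fact (1 ≤ p)]
    (α : EuclideanSpace ℝ (Fin n) → ℝ) (A : LpOn Ω p →L[ℝ] LpOn Ω p) : Prop :=
  ∀ φ : LpOn Ω p, ∀ s : ℝ, 0 ≤ s → ∀ ψ : LpOn Ω p,
    (∀ᵐ x ∂(volume.restrict Ω), ψ x = s ^ α x / Real.Gamma (α x + 1) * φ x) →
    ∀ᵐ x ∂(volume.restrict Ω), s ^ α x / Real.Gamma (α x + 1) * (A φ) x = (A ψ) x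

open scoped Topology ENNReal

/-! Since `α` takes finitely many values, L^p splits under multiplication by indicators of the level
sets `{α = a}`. The commutation condition says that `A` commutes with `∑ s^a / Γ(a + 1) P a`;
varying `s` and interpolating isolates each projection `P a` (`commute_of_commute_sum_rpow`). The
problem thus decouples into finitely many equations of constant order.

For constant order `a` the solution is the Mittag-Leffler series `∑ t^(a k) / Γ(a k + 1) A^k φ`. By
the Beta integral, `J^β` shifts its exponents by `β`, which gives the equation (`fracInt_mlOp`).
Comparing 1/Γ at real arguments with neighbouring inverse factorials bounds the series by a multiple
of `exp(‖A‖^(1/a) t)`. For uniqueness, `J^a J^(1-a) = J^1` turns the homogeneous equation into `D =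
J^a A D` for the primitive `D`, and iterating this forces `D = 0`.

What remains is to match Bochner integrals in L^p with the pointwise integrals of a jointly
measurable representative (`coeFn_integral_ae_eq`, `exists_measurable_representative`). -/

/-! ### Beta integrals and scalar Mittag-Leffler bounds -/

theorem integral_rpow_mul_sub_rpow {a b t : ℝ} (ha : 0 < a) (hb : 0 < b) (ht : 0 < t) :
    ∫ s in (0 : ℝ)..t, (t - s) ^ (b - 1) * s ^ (a - 1) =
      Real.Gamma a * Real.Gamma b / Real.Gamma (a + b) * t ^ (a + b - 1) := by
  have h1 := Complex.betaIntegral_scaled (a : ℂ) (b : ℂ) ht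
  have h2 := Complex.Gamma_mul_Gamma_eq_betaIntegral (s := (a : ℂ)) (t := (b : ℂ))
    (by simpa using ha) (by simpa using hb)
  have h3 : (Real.Gamma (a + b)) ≠ 0 := (Real.Gamma_pos_of_pos (add_pos ha hb)).ne'
  have h4 : Complex.betaIntegral a b =
      ((Real.Gamma a * Real.Gamma b / Real.Gamma (a + b) : ℝ) : ℂ) := by
    rw [← Complex.ofReal_add, Complex.Gamma_ofReal, Complex.Gamma_ofReal,
      Complex.Gamma_ofReal] at h2
    push_cast
    rw [h2, mul_div_cancel_left₀ _ (Complex.ofReal_ne_zero.2 h3)]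
  have h5 : ((∫ s in (0 : ℝ)..t, (t - s) ^ (b - 1) * s ^ (a - 1) : ℝ) : ℂ) =
      ∫ x in (0 : ℝ)..t, (x : ℂ) ^ ((a : ℂ) - 1) * ((t : ℂ) - x) ^ ((b : ℂ) - 1) := by
    rw [← intervalIntegral.integral_ofReal]
    apply intervalIntegral.integral_congr
    intro s hs
    rw [uIcc_of_le ht.le] at hs
    simp only
    push_cast [Complex.ofReal_cpow hs.1, Complex.ofReal_cpow (sub_nonneg.2 hs.2)]
    ring
  rw [h4] at h1
  rw [h1] at h5
  have h6 : ((t : ℂ) ^ ((a : ℂ) + b - 1)) = ((t ^ (a + b - 1) : ℝ) : ℂ) := by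
    rw [Complex.ofReal_cpow ht.le]; push_cast; rfl
  rw [h6, ← Complex.ofReal_mul] at h5
  rw [Complex.ofReal_injective h5, mul_comm]

/-- The integral of a nonintegrable function is 0 by convention, so the positive Beta value already
forces integrability. -/
theorem intervalIntegrable_sub_rpow_mul_rpow {a b t : ℝ} (ha : 0 < a) (hb : 0 < b) (ht : 0 ≤ t) :
    IntervalIntegrable (fun s : ℝ => (t - s) ^ (b - 1) * s ^ (a - 1)) volume 0 t := by
  rcases ht.eq_or_lt with rfl | ht
  · simp
  apply intervalIntegral.intervalIntegrable_of_integral_ne_zero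
  rw [integral_rpow_mul_sub_rpow ha hb ht]
  have := Real.Gamma_pos_of_pos ha
  have := Real.Gamma_pos_of_pos hb
  have := Real.Gamma_pos_of_pos (add_pos ha hb)
  positivity

theorem intervalIntegrable_sub_rpow {b t : ℝ} (hb : 0 < b) (ht : 0 ≤ t) :
    IntervalIntegrable (fun s : ℝ => (t - s) ^ (b - 1)) volume 0 t := by
  simpa using intervalIntegrable_sub_rpow_mul_rpow (a := 1) one_pos hb ht

/-- A power divided by the Gamma function at a real exponent is controlled by the two neighbouring
terms of the exponential series. -/
theorem rpow_div_Gamma_le {y s : ℝ} (hy : 0 < y) (hs : 0 ≤ s) :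
    y ^ s / Real.Gamma (s + 1) ≤
      y ^ (⌊s⌋₊ + 1) / ((⌊s⌋₊ + 1).factorial : ℝ) + 2 * (y ^ ⌊s⌋₊ / (⌊s⌋₊.factorial : ℝ)) := by
  set n := ⌊s⌋₊ with hn
  have hns : (n : ℝ) ≤ s := Nat.floor_le hs
  have hsn : s < n + 1 := Nat.lt_floor_add_one s
  rcases hns.eq_or_lt with h | h
  · rw [← h, Real.Gamma_nat_eq_factorial, Real.rpow_natCast]
    have : 0 ≤ y ^ (n + 1) / ((n + 1).factorial : ℝ) := by positivity
    have : 0 ≤ y ^ n / (n.factorial : ℝ) := by positivity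
    linarith
  have hG : 0 < Real.Gamma (s + 1) := Real.Gamma_pos_of_pos (by linarith)
  -- Log-convexity of Γ between `s + 1` and `s + 2`, with weights chosen so that the intermediate
  -- point is `n + 2`. It yields `(n + 1)! ≤ (s + 1)^(1 - (s - n)) Γ(s + 1)`.
  have h1 := Real.Gamma_mul_add_mul_le_rpow_Gamma_mul_rpow_Gamma (s := s + 1) (t := s + 2)
    (a := s - n) (b := 1 - (s - n)) (by linarith) (by linarith) (by linarith) (by linarith)
    (by ring)
  have h2 : (s - n) * (s + 1) + (1 - (s - n)) * (s + 2) = ((n + 1 : ℕ) : ℝ) + 1 := by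
    push_cast; ring
  rw [h2, Real.Gamma_nat_eq_factorial, show s + 2 = (s + 1) + 1 by ring,
    Real.Gamma_add_one (s := s + 1) (by linarith), Real.mul_rpow (by linarith) hG.le,
    mul_left_comm, ← Real.rpow_add hG, show s - n + (1 - (s - n)) = 1 by ring,
    Real.rpow_one] at h1
  set r : ℝ := (n + 2) / y with hr
  have hr0 : 0 < r := by positivity
  have h3 : r ^ (1 - (s - n)) ≤ 1 + r := by
    rcases le_total r 1 with h | h
    · have := Real.rpow_le_one hr0.le h (show 0 ≤ 1 - (s - n) by linarith)
      linarith
    · have := Real.rpow_le_rpow_of_exponent_le h (show 1 - (s - n) ≤ 1 by linarith)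
      rw [Real.rpow_one] at this
      linarith
  have h4 : ((n + 1).factorial : ℝ) ≤ (n + 2) ^ (1 - (s - n)) * Real.Gamma (s + 1) := by
    refine h1.trans (mul_le_mul_of_nonneg_right ?_ hG.le)
    exact Real.rpow_le_rpow (by linarith) (by linarith) (by linarith)
  have h5 : y ^ s = y ^ (n + 1) * (y ^ (1 - (s - n)))⁻¹ := by
    rw [← Real.rpow_natCast, ← Real.rpow_neg hy.le, ← Real.rpow_add hy]
    congr 1; push_cast; ring
  calc y ^ s / Real.Gamma (s + 1)
      ≤ y ^ (n + 1) / ((n + 1).factorial : ℝ) * r ^ (1 - (s - n)) := by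
        rw [h5, hr, Real.div_rpow (by positivity) hy.le, div_le_iff₀ hG]
        have hf : (0 : ℝ) < (n + 1).factorial := by positivity
        have hyp : 0 < y ^ (1 - (s - n)) := by positivity
        rw [← div_eq_mul_inv, div_le_iff₀ hyp]
        have : y ^ (n + 1) / ((n + 1).factorial : ℝ) *
            ((n + 2) ^ (1 - (s - n)) / y ^ (1 - (s - n))) * Real.Gamma (s + 1) *
              y ^ (1 - (s - n)) =
            y ^ (n + 1) * ((n + 2) ^ (1 - (s - n)) * Real.Gamma (s + 1) /
              ((n + 1).factorial : ℝ)) := by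
          field_simp
        rw [this]
        exact le_mul_of_one_le_right (by positivity) ((one_le_div hf).2 h4)
    _ ≤ y ^ (n + 1) / ((n + 1).factorial : ℝ) * (1 + r) := by gcongr
    _ ≤ _ := by
        have : y ^ (n + 1) / ((n + 1).factorial : ℝ) * r =
            y ^ n / (n.factorial : ℝ) * ((n + 2) / (n + 1)) := by
          rw [hr, Nat.factorial_succ, pow_succ]; push_cast; field_simp
        rw [mul_add, mul_one, this]
        have h6 : ((n : ℝ) + 2) / (n + 1) ≤ 2 := by
          rw [div_le_iff₀ (by positivity)]; linarith [(Nat.cast_nonneg n : (0 : ℝ) ≤ n)]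
        have : 0 ≤ y ^ n / (n.factorial : ℝ) := by positivity
        nlinarith

/-- Distinct indices congruent mod `N` differ by at least `N`, so `a k + c` moves by at least 1 and
the floor changes. Hence the floor map is at most `N`-to-one. -/
theorem injective_mod_floor {a c : ℝ} (ha : 0 < a) (hc : 0 ≤ c) {N : ℕ} [NeZero N]
    (hN : 1 ≤ a * N) :
    Function.Injective fun k : ℕ => ((Fin.ofNat N k : Fin N), ⌊a * k + c⌋₊) := by
  have key : ∀ k l : ℕ, k < l → k % N = l % N → ⌊a * k + c⌋₊ ≠ ⌊a * l + c⌋₊ := by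
    intro k l hkl hmod hfl
    have hd : N ∣ l - k := (Nat.modEq_iff_dvd' hkl.le).1 hmod
    have hle : k + N ≤ l := by
      have := Nat.le_of_dvd (by omega) hd
      omega
    have h1 : a * k + c + 1 ≤ a * l + c := by
      have : ((k + N : ℕ) : ℝ) ≤ l := by exact_mod_cast hle
      push_cast at this
      nlinarith
    have h2 := Nat.floor_le_floor h1
    rw [Nat.floor_add_one (by positivity)] at h2
    omega
  intro k l h
  simp only [Prod.mk.injEq, Fin.ext_iff, Fin.val_ofNat] at h
  rcases lt_trichotomy k l with hkl | hkl | hkl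
  · exact absurd h.2 (key k l hkl h.1)
  · exact hkl
  · exact absurd h.2.symm (key l k hkl h.1.symm)

theorem summable_comp_floor {a c : ℝ} (ha : 0 < a) (hc : 0 ≤ c) {N : ℕ} [NeZero N]
    (hN : 1 ≤ a * N) {g : ℕ → ℝ} (hg : Summable g) (hg0 : ∀ n, 0 ≤ g n) :
    (Summable fun k : ℕ => g ⌊a * k + c⌋₊) ∧ ∑' k : ℕ, g ⌊a * k + c⌋₊ ≤ N * ∑' n, g n := by
  have hs : Summable fun z : Fin N × ℕ => g z.2 :=
    (summable_prod_of_nonneg fun z => hg0 z.2).2 ⟨fun _ => hg, Summable.of_finite⟩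
  have hi := injective_mod_floor ha hc hN
  refine ⟨hs.comp_injective hi, ?_⟩
  have h2 : ∑' z : Fin N × ℕ, g z.2 = N * ∑' n, g n := by
    rw [hs.tsum_prod' fun _ => hg]; simp
  rw [← h2]
  exact tsum_comp_le_tsum_of_inj hs (fun z => hg0 z.2) hi

/-- Convergence and exponential growth of the two-parameter Mittag-Leffler series. -/
theorem mittagLeffler_summable_and_le {a : ℝ} (ha : 0 < a) :
    ∃ C : ℝ, 0 < C ∧ ∀ c y : ℝ, 0 ≤ c → 0 < y →
      (Summable fun k : ℕ => y ^ (a * k + c) / Real.Gamma (a * k + c + 1)) ∧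
      ∑' k : ℕ, y ^ (a * k + c) / Real.Gamma (a * k + c + 1) ≤ C * Real.exp y := by
  obtain ⟨N, hN⟩ := exists_nat_ge (1 / a)
  have hN' : 1 ≤ a * N := by rw [div_le_iff₀ ha] at hN; linarith
  have hN0 : N ≠ 0 := by rintro rfl; norm_num at hN'
  have : NeZero N := ⟨hN0⟩
  have hNpos : (0 : ℝ) < N := by exact_mod_cast Nat.pos_of_ne_zero hN0
  -- Each floor occurs at most `N` times and the majorant `e (n + 1) + 2 * e n` sums to at most `3
  -- exp y`; the constant depends on `a` alone.
  refine ⟨N * 3, by positivity, fun c y hc hy => ?_⟩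
  set e : ℕ → ℝ := fun n => y ^ n / (n.factorial : ℝ)
  have he : Summable e := Real.summable_pow_div_factorial y
  have he1 : Summable fun n => e (n + 1) := (summable_nat_add_iff 1).2 he
  have hsum : ∑' n, e n = Real.exp y := by
    rw [Real.exp_eq_exp_ℝ, NormedSpace.exp_eq_tsum_div]
  have hsum1 : ∑' n, e (n + 1) ≤ Real.exp y := by
    rw [← hsum, he.tsum_eq_zero_add]
    have : 0 ≤ e 0 := by positivity
    linarith
  have hg : Summable fun n => e (n + 1) + 2 * e n := he1.add (he.mul_left 2)
  obtain ⟨h1, h2⟩ := summable_comp_floor ha hc hN' hg (fun n => by positivity)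
  have hle : ∀ k : ℕ, y ^ (a * k + c) / Real.Gamma (a * k + c + 1) ≤
      e (⌊a * k + c⌋₊ + 1) + 2 * e ⌊a * k + c⌋₊ := fun k =>
    rpow_div_Gamma_le hy (by positivity)
  have h0 : ∀ k : ℕ, 0 ≤ y ^ (a * k + c) / Real.Gamma (a * k + c + 1) := fun k =>
    div_nonneg (by positivity) (Real.Gamma_pos_of_pos (by positivity)).le
  have hS := Summable.of_nonneg_of_le h0 hle h1
  refine ⟨hS, (hS.tsum_le_tsum hle h1).trans (h2.trans ?_)⟩
  rw [he1.tsum_add (he.mul_left 2), tsum_mul_left, hsum, mul_assoc]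
  gcongr
  linarith

/-! ### The Mittag-Leffler operator family -/

section

variable {E : Type*} [NormedAddCommGroup E] [NormedSpace ℝ E]

/-- The operator-valued Mittag-Leffler series `∑ t^(a k + c) / Γ(a k + c + 1) A^k`. -/
noncomputable def mlOp (a c : ℝ) (A : E →L[ℝ] E) (t : ℝ) : E →L[ℝ] E :=
  ∑' k : ℕ, (t ^ (a * k + c) / Real.Gamma (a * k + c + 1)) • A ^ k

/-- The Riemann-Liouville fractional integral of constant order of a vector-valued curve. -/
noncomputable def fracInt (β : ℝ) (v : ℝ → E) (t : ℝ) : E :=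
  open Classical in
  if β = 0 then v t
  else (1 / Real.Gamma β) • ∫ s in (0 : ℝ)..t, (t - s) ^ (β - 1) • v s

/-- Exponent 0 is separate: on the zero space the identity has norm 0, so only `‖1‖ ≤ 1` is
available. -/
theorem norm_pow_le_pow_norm (A : E →L[ℝ] E) (k : ℕ) : ‖A ^ k‖ ≤ ‖A‖ ^ k := by
  rcases Nat.eq_zero_or_pos k with rfl | hk
  · rw [pow_zero, pow_zero]; exact ContinuousLinearMap.norm_id_le
  · exact norm_pow_le' A hk

theorem summable_mlTerm {a c L t : ℝ} (ha : 0 < a) (hc : 0 ≤ c) (hL : 0 ≤ L) (ht : 0 ≤ t) :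
    Summable fun k : ℕ => t ^ (a * k + c) / Real.Gamma (a * k + c + 1) * L ^ k := by
  obtain ⟨C, hC, H⟩ := mittagLeffler_summable_and_le ha
  have hL1 : 0 < L + 1 := by linarith
  -- Rescaling time absorbs `L^k` into the power; the added 1's keep the base positive when `L` or
  -- `t` vanishes.
  have hy : 0 < (L + 1) ^ (1 / a) * (t + 1) := by positivity
  have hS := ((H c _ hc hy).1).mul_left ((L + 1) ^ (-(c / a)))
  refine Summable.of_nonneg_of_le (fun k => ?_) (fun k => ?_) hS
  · exact mul_nonneg (div_nonneg (by positivity)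
      (Real.Gamma_pos_of_pos (by positivity)).le) (by positivity)
  · have hG : 0 < Real.Gamma (a * k + c + 1) := Real.Gamma_pos_of_pos (by positivity)
    have h1 : (L + 1) ^ (-(c / a)) * ((L + 1) ^ (1 / a) * (t + 1)) ^ (a * k + c) =
        (t + 1) ^ (a * k + c) * (L + 1) ^ k := by
      rw [Real.mul_rpow (by positivity) (by positivity), ← Real.rpow_mul hL1.le, ← mul_assoc,
        ← Real.rpow_add hL1, mul_comm, ← Real.rpow_natCast]
      congr 2
      field_simp
      ring
    rw [← mul_div_assoc, h1, div_mul_eq_mul_div]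
    have h2 : t ^ (a * k + c) ≤ (t + 1) ^ (a * k + c) :=
      Real.rpow_le_rpow ht (by linarith) (by positivity)
    have h3 : L ^ k ≤ (L + 1) ^ k := pow_le_pow_left₀ hL (by linarith) k
    gcongr

theorem norm_mlOp_term_le {a c t T : ℝ} (ha : 0 < a) (hc : 0 ≤ c) (ht : 0 ≤ t) (htT : t ≤ T)
    (A : E →L[ℝ] E) (k : ℕ) :
    ‖(t ^ (a * k + c) / Real.Gamma (a * k + c + 1)) • A ^ k‖ ≤
      T ^ (a * k + c) / Real.Gamma (a * k + c + 1) * ‖A‖ ^ k := by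
  have hG : 0 < Real.Gamma (a * k + c + 1) := Real.Gamma_pos_of_pos (by positivity)
  have h2 : t ^ (a * k + c) ≤ T ^ (a * k + c) := Real.rpow_le_rpow ht htT (by positivity)
  have h3 := norm_pow_le_pow_norm A k
  have h4 : 0 ≤ t ^ (a * k + c) := by positivity
  rw [norm_smul, Real.norm_of_nonneg (by positivity)]
  exact mul_le_mul (div_le_div_of_nonneg_right h2 hG.le) h3 (norm_nonneg _)
    (div_nonneg (h4.trans h2) hG.le)

/-- Exponential growth of the Mittag-Leffler operator family. -/
theorem exists_norm_mlOp_le {a : ℝ} (ha : 0 < a) (A : E →L[ℝ] E) :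
    ∃ C : ℝ, 0 < C ∧ ∀ t : ℝ, 0 ≤ t →
      ‖mlOp a 0 A t‖ ≤ C * Real.exp (‖A‖ ^ (1 / a) * t) := by
  obtain ⟨C, hC, H⟩ := mittagLeffler_summable_and_le ha
  -- The extra 1 covers `y = 0` below, where only the term `k = 0`, equal to 1, survives.
  refine ⟨C + 1, by linarith, fun t ht => ?_⟩
  have hs := summable_mlTerm ha le_rfl (norm_nonneg A) ht
  have h1 : ‖mlOp a 0 A t‖ ≤
      ∑' k : ℕ, t ^ (a * k + 0) / Real.Gamma (a * k + 0 + 1) * ‖A‖ ^ k :=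
    tsum_of_norm_bounded hs.hasSum fun k => norm_mlOp_term_le ha le_rfl ht le_rfl A k
  refine h1.trans ?_
  set y := ‖A‖ ^ (1 / a) * t with hy
  have hy0 : 0 ≤ y := by positivity
  have h2 : ∀ k : ℕ, t ^ (a * k + 0) / Real.Gamma (a * k + 0 + 1) * ‖A‖ ^ k =
      y ^ (a * k + 0) / Real.Gamma (a * k + 0 + 1) := fun k => by
    rw [hy, Real.mul_rpow (by positivity) ht, ← Real.rpow_mul (norm_nonneg A),
      show 1 / a * (a * k + 0) = k by field_simp; ring, Real.rpow_natCast]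
    ring
  rw [tsum_congr h2]
  rcases hy0.eq_or_lt with h | h
  · rw [← h, tsum_eq_single 0 fun k hk => ?_]
    · simp; linarith
    · rw [Real.zero_rpow (by positivity), zero_div]
  · have := (H 0 y le_rfl h).2
    have := Real.exp_pos y
    linarith

theorem mlOp_zero_time {a : ℝ} (ha : 0 < a) (A : E →L[ℝ] E) : mlOp a 0 A 0 = 1 := by
  rw [mlOp, tsum_eq_single 0 fun k hk => ?_]
  · simp
  · rw [Real.zero_rpow (by positivity), zero_div, zero_smul]

variable [CompleteSpace E]

theorem summable_mlOp {a c t : ℝ} (ha : 0 < a) (hc : 0 ≤ c) (ht : 0 ≤ t) (A : E →L[ℝ] E) :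
    Summable fun k : ℕ => (t ^ (a * k + c) / Real.Gamma (a * k + c + 1)) • A ^ k :=
  Summable.of_norm_bounded (summable_mlTerm ha hc (norm_nonneg A) ht)
    fun k => norm_mlOp_term_le ha hc ht le_rfl A k

theorem hasSum_mlOp_apply {a c t : ℝ} (ha : 0 < a) (hc : 0 ≤ c) (ht : 0 ≤ t) (A : E →L[ℝ] E)
    (φ : E) : HasSum (fun k : ℕ => (t ^ (a * k + c) / Real.Gamma (a * k + c + 1)) • (A ^ k) φ)
      (mlOp a c A t φ) := by
  have := (summable_mlOp ha hc ht A).hasSum.mapL (ContinuousLinearMap.apply ℝ E φ)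
  simpa [mlOp] using this

theorem continuousOn_mlOp {a c : ℝ} (ha : 0 < a) (hc : 0 ≤ c) (A : E →L[ℝ] E) :
    ContinuousOn (mlOp a c A) (Ici 0) := by
  intro t ht
  have ht : 0 ≤ t := ht
  have h1 : ContinuousOn (mlOp a c A) (Icc 0 (t + 1)) := by
    unfold mlOp
    refine continuousOn_tsum (fun k => ?_)
      (summable_mlTerm ha hc (norm_nonneg A) (by linarith : 0 ≤ t + 1))
      (fun k s hs => norm_mlOp_term_le ha hc hs.1 hs.2 A k)
    have h2 : Continuous fun s : ℝ => s ^ (a * k + c) :=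
      Real.continuous_rpow_const (by positivity)
    fun_prop
  refine (h1 t ⟨ht, by linarith⟩).mono_of_mem_nhdsWithin ?_
  rw [mem_nhdsWithin_iff_exists_mem_nhds_inter]
  exact ⟨Iio (t + 1), Iio_mem_nhds (by linarith), fun s hs => ⟨hs.2, le_of_lt hs.1⟩⟩

theorem mlOp_eq_one_add {a t : ℝ} (ha : 0 < a) (ht : 0 ≤ t) (A : E →L[ℝ] E) :
    mlOp a 0 A t = 1 + A * mlOp a a A t := by
  have h := summable_mlOp ha le_rfl ht A
  rw [mlOp, h.tsum_eq_zero_add, mlOp, ← (summable_mlOp ha ha.le ht A).tsum_mul_left]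
  congr 1
  · simp
  · refine tsum_congr fun k => ?_
    rw [mul_smul_comm, ← pow_succ']
    congr 2 <;> push_cast <;> ring_nf

theorem commute_mlOp {a c t : ℝ} (ha : 0 < a) (hc : 0 ≤ c) (ht : 0 ≤ t) {A B : E →L[ℝ] E}
    (h : Commute B A) : Commute B (mlOp a c A t) := by
  have hs := summable_mlOp ha hc ht A
  rw [commute_iff_eq, mlOp, ← hs.tsum_mul_left, ← hs.tsum_mul_right]
  exact tsum_congr fun k => ((h.pow_right k).smul_right _).eq

/-- Fractional integration raises the offset `c` by `β`: termwise this is the Beta integral, and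
dominated convergence permits the exchange with the sum. -/
theorem integral_sub_rpow_smul_mlOp {a c β t : ℝ} (ha : 0 < a) (hc : 0 ≤ c) (hβ : 0 < β)
    (ht : 0 ≤ t) (A : E →L[ℝ] E) (φ : E) :
    ∫ s in (0 : ℝ)..t, (t - s) ^ (β - 1) • mlOp a c A s φ =
      Real.Gamma β • mlOp a (c + β) A t φ := by
  have h1 := intervalIntegral.hasSum_integral_of_dominated_convergence (μ := volume)
    (a := 0) (b := t)
    (F := fun (k : ℕ) s => (t - s) ^ (β - 1) •
      (s ^ (a * k + c) / Real.Gamma (a * k + c + 1)) • (A ^ k) φ)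
    (f := fun s => (t - s) ^ (β - 1) • mlOp a c A s φ)
    (fun k s => (t - s) ^ (β - 1) *
      (t ^ (a * k + c) / Real.Gamma (a * k + c + 1) * ‖A‖ ^ k * ‖φ‖)) ?_ ?_ ?_ ?_ ?_
  · refine h1.unique ?_
    have h2 := (hasSum_mlOp_apply ha (add_nonneg hc hβ.le) ht A φ).const_smul (Real.Gamma β)
    refine h2.congr_fun fun k => ?_
    have hG : 0 < Real.Gamma (a * k + c + 1) := Real.Gamma_pos_of_pos (by positivity)
    have h3 : ∀ s : ℝ, (t - s) ^ (β - 1) • (s ^ (a * k + c) / Real.Gamma (a * k + c + 1)) •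
        (A ^ k) φ = ((t - s) ^ (β - 1) * s ^ (a * k + c + 1 - 1)) •
          (1 / Real.Gamma (a * k + c + 1)) • (A ^ k) φ := fun s => by
      rw [smul_smul, smul_smul, add_sub_cancel_right]; congr 1; ring
    simp_rw [h3]
    rw [intervalIntegral.integral_smul_const]
    rcases ht.eq_or_lt with rfl | ht
    · rw [Real.zero_rpow (by positivity)]; simp
    · rw [integral_rpow_mul_sub_rpow (by positivity) hβ ht, smul_smul, smul_smul]
      congr 1
      rw [show a * k + c + 1 + β - 1 = a * k + (c + β) by ring,
        show a * k + c + 1 + β = a * k + (c + β) + 1 by ring]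
      field_simp
  · intro k
    have h2 : Measurable fun s : ℝ => (t - s) ^ (β - 1) := by fun_prop
    have h3 : Measurable fun s : ℝ => s ^ (a * k + c) := by fun_prop
    have h4 : StronglyMeasurable fun s : ℝ => s ^ (a * k + c) / Real.Gamma (a * k + c + 1) :=
      (h3.div_const _).stronglyMeasurable
    exact (h2.stronglyMeasurable.smul (h4.smul_const _)).aestronglyMeasurable
  · intro k
    refine Filter.Eventually.of_forall fun s hs => ?_
    rw [uIoc_of_le ht] at hs
    have h3 : 0 ≤ t - s := sub_nonneg.2 hs.2
    rw [norm_smul, Real.norm_of_nonneg (by positivity)]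
    gcongr
    have := (ContinuousLinearMap.le_opNorm
      ((s ^ (a * k + c) / Real.Gamma (a * k + c + 1)) • A ^ k) φ)
    refine this.trans ?_
    gcongr
    exact norm_mlOp_term_le ha hc hs.1.le hs.2 A k
  · refine Filter.Eventually.of_forall fun s hs => ?_
    exact ((summable_mlTerm ha hc (norm_nonneg A) ht).mul_right _).mul_left _
  · simp_rw [tsum_mul_left]
    exact (intervalIntegrable_sub_rpow hβ ht).mul_const _
  · refine Filter.Eventually.of_forall fun s hs => ?_
    rw [uIoc_of_le ht] at hs
    exact (hasSum_mlOp_apply ha hc hs.1.le A φ).const_smul _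

/-- Removing the term `k = 0` leaves the series of offset `a` applied to `A φ`; `J^(1-a)` lifts the
offset to 1, which is also the result of integrating the offset-0 series once. -/
theorem fracInt_mlOp {a t : ℝ} (ha : 0 < a) (ha1 : a ≤ 1) (ht : 0 ≤ t) (A : E →L[ℝ] E) (φ : E) :
    fracInt (1 - a) (fun s => mlOp a 0 A s φ - mlOp a 0 A 0 φ) t =
      ∫ s in (0 : ℝ)..t, A (mlOp a 0 A s φ) := by
  have h1 : ∀ s, 0 ≤ s → mlOp a 0 A s φ - mlOp a 0 A 0 φ = mlOp a a A s (A φ) := fun s hs => by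
    have hc : Commute A (mlOp a a A s) := commute_mlOp ha ha.le hs (Commute.refl A)
    rw [mlOp_zero_time ha, mlOp_eq_one_add ha hs, hc.eq]; simp
  have h2 : ∀ s, 0 ≤ s → A (mlOp a 0 A s φ) = mlOp a 0 A s (A φ) := fun s hs => by
    have hc : Commute A (mlOp a 0 A s) := commute_mlOp ha le_rfl hs (Commute.refl A)
    exact congrArg (fun B : E →L[ℝ] E => B φ) hc.eq
  have h3 : ∫ s in (0 : ℝ)..t, A (mlOp a 0 A s φ) = mlOp a 1 A t (A φ) := by
    have := integral_sub_rpow_smul_mlOp ha le_rfl one_pos ht A (A φ)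
    rw [zero_add, Real.Gamma_one, one_smul] at this
    rw [← this]
    refine intervalIntegral.integral_congr fun s hs => ?_
    rw [uIcc_of_le ht] at hs
    simp [h2 s hs.1]
  rw [h3, fracInt]
  split_ifs with h
  · rw [h1 t ht, show a = 1 by linarith]
  · have hb : 0 < 1 - a := lt_of_le_of_ne (by linarith) (Ne.symm h)
    have h4 : ∫ s in (0 : ℝ)..t, (t - s) ^ (1 - a - 1) • (mlOp a 0 A s φ - mlOp a 0 A 0 φ) =
        ∫ s in (0 : ℝ)..t, (t - s) ^ (1 - a - 1) • mlOp a a A s (A φ) := by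
      refine intervalIntegral.integral_congr fun s hs => ?_
      rw [uIcc_of_le ht] at hs
      simp [h1 s hs.1]
    rw [h4, integral_sub_rpow_smul_mlOp ha ha.le hb ht, smul_smul,
      one_div_mul_cancel (Real.Gamma_pos_of_pos hb).ne', one_smul, add_sub_cancel]

end

/-! ### Uniqueness for constant order -/

section

theorem intervalIntegrable_of_continuousOn_Ici {F : Type*} [NormedAddCommGroup F] {v : ℝ → F}
    (hv : ContinuousOn v (Ici 0)) {t : ℝ} (ht : 0 ≤ t) : IntervalIntegrable v volume 0 t :=
  (hv.mono fun s hs => by rw [uIcc_of_le ht] at hs; exact hs.1).intervalIntegrable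

variable {E : Type*} [NormedAddCommGroup E] [NormedSpace ℝ E]

theorem ContinuousOn.const_clm_apply {v : ℝ → E} {S : Set ℝ} (hv : ContinuousOn v S)
    (B : E →L[ℝ] E) : ContinuousOn (fun s => B (v s)) S :=
  B.continuous.comp_continuousOn hv

theorem ContinuousOn.sub_vector {F : Type*} [NormedAddCommGroup F] {v : ℝ → F} {S : Set ℝ}
    (hv : ContinuousOn v S) (φ : F) :
    ContinuousOn (fun s => v s - φ) S :=
  hv.sub continuousOn_const

theorem integral_congr_Ici {F : Type*} [NormedAddCommGroup F] [NormedSpace ℝ F] {v w : ℝ → F}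
    {t : ℝ} (ht : 0 ≤ t) (h : ∀ s, 0 ≤ s → v s = w s) :
    ∫ s in (0 : ℝ)..t, v s = ∫ s in (0 : ℝ)..t, w s :=
  intervalIntegral.integral_congr fun s hs => h s (by rw [uIcc_of_le ht] at hs; exact hs.1)

theorem fracInt_congr {β t : ℝ} {v w : ℝ → E} (ht : 0 ≤ t) (h : ∀ s, 0 ≤ s → v s = w s) :
    fracInt β v t = fracInt β w t := by
  unfold fracInt
  rw [h t ht, integral_congr_Ici ht fun s hs => by rw [h s hs]]

theorem continuous_comp_max_zero {F : Type*} [TopologicalSpace F] {v : ℝ → F}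
    (hv : ContinuousOn v (Ici 0)) : Continuous fun s => v (max s 0) :=
  hv.comp_continuous (continuous_id.max continuous_const) fun s => le_max_right s 0

/-- A continuous curve fixed by `J^a A` vanishes. -/
theorem eq_zero_of_eq_fracInt {a : ℝ} (ha : 0 < a) (A : E →L[ℝ] E) {v : ℝ → E}
    (hv : Continuous v) (h : ∀ t, 0 ≤ t → v t = fracInt a (fun s => A (v s)) t) {t : ℝ}
    (ht : 0 ≤ t) : v t = 0 := by
  obtain ⟨C, hC⟩ := (isCompact_Icc (a := (0 : ℝ)) (b := t)).exists_bound_of_continuousOn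
    hv.continuousOn
  have hGa := Real.Gamma_pos_of_pos ha
  -- Each substitution of the equation into itself gains one factor `J^a A`. The bound is a term of
  -- a convergent Mittag-Leffler series, hence tends to 0.
  have key : ∀ n : ℕ, ∀ s ∈ Icc 0 t,
      ‖v s‖ ≤ C * (s ^ (a * n + 0) / Real.Gamma (a * n + 0 + 1) * ‖A‖ ^ n) := by
    intro n
    induction n with
    | zero => intro s hs; simpa using hC s hs
    | succ n ih =>
      intro s hs
      have hG : 0 < Real.Gamma (a * n + 0 + 1) := Real.Gamma_pos_of_pos (by positivity)
      have hpos : 0 < a * n + 0 + 1 := by positivity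
      have h1 : ‖∫ r in (0 : ℝ)..s, (s - r) ^ (a - 1) • A (v r)‖ ≤
          ∫ r in (0 : ℝ)..s, ((s - r) ^ (a - 1) * r ^ (a * n + 0 + 1 - 1)) *
            (‖A‖ ^ (n + 1) * C / Real.Gamma (a * n + 0 + 1)) := by
        refine intervalIntegral.norm_integral_le_of_norm_le hs.1
          (Filter.Eventually.of_forall fun r hr => ?_)
          ((intervalIntegrable_sub_rpow_mul_rpow hpos ha hs.1).mul_const _)
        have h3 : 0 ≤ s - r := sub_nonneg.2 hr.2
        rw [norm_smul, Real.norm_of_nonneg (by positivity), mul_assoc]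
        refine mul_le_mul_of_nonneg_left ?_ (by positivity)
        refine (A.le_opNorm _).trans ((mul_le_mul_of_nonneg_left
          (ih r ⟨hr.1.le, hr.2.trans hs.2⟩) (norm_nonneg _)).trans (le_of_eq ?_))
        rw [add_sub_cancel_right]; ring
      rw [intervalIntegral.integral_mul_const] at h1
      rw [h s hs.1, fracInt, if_neg ha.ne', norm_smul, Real.norm_of_nonneg (by positivity)]
      refine (mul_le_mul_of_nonneg_left h1 (by positivity)).trans (le_of_eq ?_)
      rcases hs.1.eq_or_lt with h0 | h0
      · rw [← h0, Real.zero_rpow (by positivity)]; simp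
      · rw [integral_rpow_mul_sub_rpow hpos ha h0,
          show a * n + 0 + 1 + a - 1 = a * ((n + 1 : ℕ) : ℝ) + 0 by push_cast; ring,
          show a * n + 0 + 1 + a = a * ((n + 1 : ℕ) : ℝ) + 0 + 1 by push_cast; ring]
        field_simp
  have h2 := ((summable_mlTerm ha le_rfl (norm_nonneg A) ht).tendsto_atTop_zero).const_mul C
  rw [mul_zero] at h2
  exact norm_le_zero_iff.1 (ge_of_tendsto' h2 fun n => key n t ⟨ht, le_rfl⟩)

theorem intervalIntegrable_sub_rpow_smul {β t : ℝ} (hβ : 0 < β) (ht : 0 ≤ t) {v : ℝ → E}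
    (hv : ContinuousOn v (Ici 0)) :
    IntervalIntegrable (fun s => (t - s) ^ (β - 1) • v s) volume 0 t :=
  (intervalIntegrable_sub_rpow hβ ht).smul_continuousOn
    (hv.mono fun s hs => by rw [uIcc_of_le ht] at hs; exact hs.1)

theorem fracInt_sub {β t : ℝ} (hβ : 0 ≤ β) (ht : 0 ≤ t) {v w : ℝ → E}
    (hv : ContinuousOn v (Ici 0)) (hw : ContinuousOn w (Ici 0)) :
    fracInt β (fun s => v s - w s) t = fracInt β v t - fracInt β w t := by
  unfold fracInt
  split_ifs with h
  · rfl
  · have hβ' : 0 < β := lt_of_le_of_ne hβ (Ne.symm h)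
    rw [← smul_sub, ← intervalIntegral.integral_sub (intervalIntegrable_sub_rpow_smul hβ' ht hv)
      (intervalIntegrable_sub_rpow_smul hβ' ht hw)]
    simp_rw [smul_sub]

variable [CompleteSpace E]

theorem hasDerivWithinAt_integral_Ici {v : ℝ → E} (hv : ContinuousOn v (Ici 0)) {t : ℝ}
    (ht : 0 ≤ t) : HasDerivWithinAt (fun t => ∫ s in (0 : ℝ)..t, v s) (v t) (Ici 0) t := by
  have hc := continuous_comp_max_zero hv
  have h1 := (hc.integral_hasStrictDerivAt 0 t).hasDerivAt.hasDerivWithinAt (s := Ici 0)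
  rw [max_eq_left ht] at h1
  have h2 : ∀ r ∈ Ici (0 : ℝ), ∫ s in (0 : ℝ)..r, v s = ∫ s in (0 : ℝ)..r, v (max s 0) :=
    fun r hr => integral_congr_Ici hr fun s hs => by rw [max_eq_left hs]
  exact h1.congr h2 (h2 t ht)

/-- The Abel kernel of order `(a, 1 - a)` on the triangle `r ≤ s`. -/
noncomputable def abelKernel (a t : ℝ) (z : ℝ × ℝ) : ℝ :=
  {z : ℝ × ℝ | z.2 ≤ z.1}.indicator (fun z => (t - z.1) ^ (a - 1) * (z.1 - z.2) ^ (-a)) z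

theorem measurable_abelKernel (a t : ℝ) : Measurable (abelKernel a t) := by
  unfold abelKernel
  refine Measurable.indicator ?_ (measurableSet_le measurable_snd measurable_fst)
  fun_prop

/-- After translation by `r` this is a Beta integral with exponents summing to 1, so the power of `t
- r` is 0 and the value does not depend on `r`. -/
theorem integrableOn_integral_abelKernel {a t r : ℝ} (ha : 0 < a) (ha1 : a < 1) (hr : 0 < r)
    (hrt : r < t) :
    IntegrableOn (fun s => abelKernel a t (s, r)) (Ioc 0 t) ∧
      ∫ s in Ioc 0 t, abelKernel a t (s, r) = Real.Gamma a * Real.Gamma (1 - a) := by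
  have hb : 0 < 1 - a := by linarith
  have h0 : (fun s => abelKernel a t (s, r)) =
      (Ici r).indicator fun s => (t - s) ^ (a - 1) * (s - r) ^ (-a) := rfl
  have h1 : Ioc 0 t ∩ Ici r = Icc r t := by
    ext s; simp only [mem_inter_iff, mem_Ioc, mem_Ici, mem_Icc]
    exact ⟨fun h => ⟨h.2, h.1.2⟩, fun h => ⟨⟨by linarith [h.1], h.2⟩, h.1⟩⟩
  have hI := intervalIntegrable_sub_rpow_mul_rpow hb ha (sub_nonneg.2 hrt.le)
  have hV := integral_rpow_mul_sub_rpow hb ha (sub_pos.2 hrt)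
  have hI' := hI.comp_sub_right r
  have hV' := intervalIntegral.integral_comp_sub_right (a := r) (b := t)
    (fun s => (t - r - s) ^ (a - 1) * s ^ (1 - a - 1)) r
  have e : ∀ s : ℝ, (t - r - (s - r)) ^ (a - 1) * (s - r) ^ (1 - a - 1) =
      (t - s) ^ (a - 1) * (s - r) ^ (-a) := fun s => by
    congr 2 <;> ring
  simp only [e, zero_add, sub_add_cancel] at hI'
  simp only [e, sub_self] at hV'
  rw [hV, intervalIntegral.integral_of_le hrt.le, ← integral_Icc_eq_integral_Ioc] at hV'
  rw [intervalIntegrable_iff_integrableOn_Icc_of_le hrt.le] at hI'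
  rw [h0]
  constructor
  · rwa [integrableOn_indicator_iff measurableSet_Ici, inter_comm, h1]
  · rw [setIntegral_indicator measurableSet_Ici, h1, hV']
    simp [mul_comm]

theorem integrable_abelKernel {a t : ℝ} (ha : 0 < a) (ha1 : a < 1) :
    Integrable (abelKernel a t)
      ((volume.restrict (Ioc 0 t)).prod (volume.restrict (Ioc 0 t))) := by
  have hae : ∀ᵐ r ∂(volume.restrict (Ioc 0 t)), 0 < r ∧ r < t := by
    rw [← Measure.restrict_congr_set (Ioo_ae_eq_Ioc (μ := volume) (a := (0 : ℝ)) (b := t))]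
    exact ae_restrict_mem measurableSet_Ioo
  rw [integrable_prod_iff' (measurable_abelKernel a t).aestronglyMeasurable]
  constructor
  · filter_upwards [hae] with r hr
    exact (integrableOn_integral_abelKernel ha ha1 hr.1 hr.2).1
  · refine (integrable_const (Real.Gamma a * Real.Gamma (1 - a))).congr ?_
    filter_upwards [hae] with r hr
    rw [← (integrableOn_integral_abelKernel ha ha1 hr.1 hr.2).2]
    refine setIntegral_congr_fun measurableSet_Ioc fun s hs => ?_
    rw [Real.norm_of_nonneg]
    refine indicator_nonneg (s := {z : ℝ × ℝ | z.2 ≤ z.1 ∧ z.1 ≤ t})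
      (f := fun z => (t - z.1) ^ (a - 1) * (z.1 - z.2) ^ (-a)) (fun z hz => ?_) (s, r) |>.trans
      (le_of_eq ?_)
    · have h1 : 0 ≤ z.1 - z.2 := sub_nonneg.2 hz.1
      have h2 : 0 ≤ t - z.1 := sub_nonneg.2 hz.2
      positivity
    · simp [abelKernel, indicator, hs.2]

/-- Abel's inversion: Fubini on the triangle `r ≤ s ≤ t`, where integrating out `s` leaves the
constant `Γ(a) Γ(1 - a)`. -/
theorem fracInt_fracInt {a t : ℝ} (ha : 0 < a) (ha1 : a < 1) (ht : 0 ≤ t) {v : ℝ → E}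
    (hv : Continuous v) :
    fracInt a (fracInt (1 - a) v) t = ∫ s in (0 : ℝ)..t, v s := by
  have hb : 0 < 1 - a := by linarith
  have hGa := Real.Gamma_pos_of_pos ha
  have hGb := Real.Gamma_pos_of_pos hb
  have hae : ∀ᵐ r ∂(volume.restrict (Ioc 0 t)), 0 < r ∧ r < t := by
    rw [← Measure.restrict_congr_set (Ioo_ae_eq_Ioc (μ := volume) (a := (0 : ℝ)) (b := t))]
    exact ae_restrict_mem measurableSet_Ioo
  obtain ⟨C, hC⟩ := (isCompact_Icc (a := (0 : ℝ)) (b := t)).exists_bound_of_continuousOn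
    hv.continuousOn
  have hint : Integrable (Function.uncurry fun s r => abelKernel a t (s, r) • v r)
      ((volume.restrict (Ioc 0 t)).prod (volume.restrict (Ioc 0 t))) := by
    refine ((integrable_abelKernel ha ha1).norm.mul_const C).mono' ?_ ?_
    · exact ((measurable_abelKernel a t).stronglyMeasurable.aestronglyMeasurable).smul
        (hv.comp continuous_snd).aestronglyMeasurable
    · rw [Measure.prod_restrict]
      filter_upwards [ae_restrict_mem (measurableSet_Ioc.prod measurableSet_Ioc)] with z hz
      simp only [Function.uncurry, norm_smul]
      exact mul_le_mul_of_nonneg_left (hC z.2 (Ioc_subset_Icc_self hz.2)) (norm_nonneg _)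
  have hswap := integral_integral_swap hint
  have hR : ∫ r in Ioc 0 t, ∫ s in Ioc 0 t, abelKernel a t (s, r) • v r =
      (Real.Gamma a * Real.Gamma (1 - a)) • ∫ r in Ioc 0 t, v r := by
    rw [← integral_smul]
    refine integral_congr_ae ?_
    filter_upwards [hae] with r hr
    rw [integral_smul_const, (integrableOn_integral_abelKernel ha ha1 hr.1 hr.2).2]
  have hL : ∫ s in Ioc 0 t, ∫ r in Ioc 0 t, abelKernel a t (s, r) • v r =
      Real.Gamma (1 - a) • ∫ s in (0 : ℝ)..t, (t - s) ^ (a - 1) • fracInt (1 - a) v s := by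
    rw [intervalIntegral.integral_of_le ht, ← integral_smul]
    refine setIntegral_congr_fun measurableSet_Ioc fun s hs => ?_
    have h0 : (fun r => abelKernel a t (s, r) • v r) =
        (Iic s).indicator fun r => ((t - s) ^ (a - 1) * (s - r) ^ (-a)) • v r := by
      ext r
      by_cases h : r ≤ s
      · simp [abelKernel, h]
      · simp [abelKernel, h]
    have h1 : Ioc 0 t ∩ Iic s = Ioc 0 s := by
      rw [Ioc_inter_Iic, min_eq_right hs.2]
    simp only [h0]
    rw [setIntegral_indicator measurableSet_Iic, h1]
    simp_rw [mul_smul]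
    rw [integral_smul, fracInt, if_neg hb.ne', intervalIntegral.integral_of_le hs.1.le,
      smul_comm (Real.Gamma (1 - a)), smul_smul (Real.Gamma (1 - a)),
      mul_one_div_cancel hGb.ne', one_smul, show 1 - a - 1 = -a by ring]
  rw [hL, hR] at hswap
  rw [fracInt, if_neg ha.ne', intervalIntegral.integral_of_le ht (f := v)]
  have h2 := congrArg (fun x => (1 / (Real.Gamma a * Real.Gamma (1 - a))) • x) hswap
  simp only [smul_smul] at h2
  rw [one_div_mul_cancel (by positivity), one_smul] at h2
  rw [← h2]
  congr 1
  field_simp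

theorem fracInt_clm {β t : ℝ} (hβ : 0 ≤ β) (ht : 0 ≤ t) {v : ℝ → E}
    (hv : ContinuousOn v (Ici 0)) (B : E →L[ℝ] E) :
    fracInt β (fun s => B (v s)) t = B (fracInt β v t) := by
  unfold fracInt
  split_ifs with h
  · rfl
  · rw [map_smul, ← ContinuousLinearMap.intervalIntegral_comp_comm]
    · simp
    · exact intervalIntegrable_sub_rpow_smul (lt_of_le_of_ne hβ (Ne.symm h)) ht hv

/-- Uniqueness for the integrated fractional equation of constant order. -/
theorem eq_zero_of_fracInt_eq_integral {a : ℝ} (ha : 0 < a) (ha1 : a ≤ 1) (A : E →L[ℝ] E)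
    {v : ℝ → E} (hv : ContinuousOn v (Ici 0))
    (h : ∀ t, 0 ≤ t → fracInt (1 - a) v t = ∫ s in (0 : ℝ)..t, A (v s)) {t : ℝ}
    (ht : 0 ≤ t) : v t = 0 := by
  set d : ℝ → E := fun s => v (max s 0)
  have hd : Continuous d := continuous_comp_max_zero hv
  have hdv : ∀ s, 0 ≤ s → v s = d s := fun s hs => by simp only [d]; rw [max_eq_left hs]
  -- The hypothesis reads `J^(1-a) d = A D`. Applying `J^a` gives `D = J^a A D`, so `D = 0` on `[0,
  -- ∞)` and its derivative `d` vanishes there.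
  set D : ℝ → E := fun t => ∫ s in (0 : ℝ)..t, d s
  have hDd : ∀ t, HasDerivAt D (d t) t := fun t =>
    (hd.integral_hasStrictDerivAt 0 t).hasDerivAt
  have hD : Continuous D := continuous_iff_continuousAt.2 fun t => (hDd t).continuousAt
  have h' : ∀ t, 0 ≤ t → fracInt (1 - a) d t = A (D t) := fun t ht => by
    rw [← fracInt_congr ht hdv, h t ht, integral_congr_Ici ht fun s hs => by rw [hdv s hs],
      ContinuousLinearMap.intervalIntegral_comp_comm _ (hd.intervalIntegrable 0 t)]
  have hDa : ∀ t, 0 ≤ t → D t = fracInt a (fun s => A (D s)) t := fun t ht => by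
    rw [← fracInt_congr ht h']
    rcases ha1.eq_or_lt with rfl | ha1
    · simp [fracInt, D]
    · exact (fracInt_fracInt ha ha1 ht hd).symm
  have hD0 : ∀ t ∈ Ici (0 : ℝ), D t = 0 := fun t ht => eq_zero_of_eq_fracInt ha A hD hDa ht
  have h1 : HasDerivWithinAt D 0 (Ici 0) t :=
    (hasDerivWithinAt_const t (Ici 0) (0 : E)).congr hD0 (hD0 t ht)
  rw [hdv t ht]
  exact (uniqueDiffOn_Ici 0 t ht).eq_deriv _ (hDd t).hasDerivWithinAt h1

end

/-! ### Gluing finitely many orders -/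

section

variable {E : Type*} [NormedAddCommGroup E] [NormedSpace ℝ E]

/-- A finite decomposition of the identity into mutually annihilating projections that commute
with `A`, indexed by orders in `(0, 1]`. -/
structure OrderDecomposition (V : Finset ℝ) (P : ℝ → E →L[ℝ] E) (A : E →L[ℝ] E) : Prop where
  pos : ∀ a ∈ V, 0 < a
  le_one : ∀ a ∈ V, a ≤ 1
  sum_apply : ∀ φ, ∑ a ∈ V, P a φ = φ
  proj : ∀ a φ, P a (P a φ) = P a φ
  ortho : ∀ a b φ, a ≠ b → P a (P b φ) = 0
  comm : ∀ a ∈ V, Commute (P a) A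

/-- The fractional integral whose order on the range of `P a` is `1 - a`. -/
noncomputable def mixedInt (V : Finset ℝ) (P : ℝ → E →L[ℝ] E) (v : ℝ → E) (t : ℝ) : E :=
  ∑ a ∈ V, P a (fracInt (1 - a) v t)

/-- The solution family of the fractional equation whose order on the range of `P a` is `a`. -/
noncomputable def mixedOp (V : Finset ℝ) (P : ℝ → E →L[ℝ] E) (A : E →L[ℝ] E) (t : ℝ) :
    E →L[ℝ] E :=
  ∑ a ∈ V, mlOp a 0 A t * P a

namespace OrderDecomposition

variable {V : Finset ℝ} {P : ℝ → E →L[ℝ] E} {A : E →L[ℝ] E}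

theorem proj_sum (h : OrderDecomposition V P A) {a : ℝ} (ha : a ∈ V) (f : ℝ → E) :
    P a (∑ b ∈ V, P b (f b)) = P a (f a) := by
  rw [map_sum, Finset.sum_eq_single a, h.proj]
  · exact fun b _ hb => h.ortho a b _ hb.symm
  · exact fun ha' => absurd ha ha'

theorem mixedOp_zero (h : OrderDecomposition V P A) (φ : E) : mixedOp V P A 0 φ = φ := by
  conv_rhs => rw [← h.sum_apply φ]
  rw [mixedOp, _root_.sum_apply]
  refine Finset.sum_congr rfl fun a ha => ?_
  rw [mlOp_zero_time (h.pos a ha)]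
  rfl

theorem exists_norm_mixedOp_le (h : OrderDecomposition V P A) {Λ : ℝ}
    (hΛ : ∀ a ∈ V, ‖A‖ ^ (1 / a) ≤ Λ) :
    ∃ M : ℝ, 0 < M ∧ ∀ t : ℝ, 0 ≤ t → ‖mixedOp V P A t‖ ≤ M * Real.exp (Λ * t) := by
  have H : ∀ a : ℝ, ∃ C : ℝ, 0 < C ∧ (a ∈ V → ∀ t : ℝ, 0 ≤ t →
      ‖mlOp a 0 A t‖ ≤ C * Real.exp (‖A‖ ^ (1 / a) * t)) := fun a => by
    by_cases ha : a ∈ V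
    · obtain ⟨C, hC, hb⟩ := exists_norm_mlOp_le (h.pos a ha) A
      exact ⟨C, hC, fun _ => hb⟩
    · exact ⟨1, one_pos, fun ha' => absurd ha' ha⟩
  choose C hC hb using H
  have h0 : 0 ≤ ∑ a ∈ V, C a * ‖P a‖ :=
    Finset.sum_nonneg fun a _ => mul_nonneg (hC a).le (norm_nonneg _)
  -- The added 1 keeps the constant positive even if every projection is zero.
  refine ⟨∑ a ∈ V, C a * ‖P a‖ + 1, by linarith, fun t ht => ?_⟩
  have h1 : ‖mixedOp V P A t‖ ≤ ∑ a ∈ V, C a * ‖P a‖ * Real.exp (Λ * t) := by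
    refine (norm_sum_le _ _).trans (Finset.sum_le_sum fun a ha => ?_)
    refine (norm_mul_le _ _).trans ?_
    rw [mul_right_comm]
    refine mul_le_mul_of_nonneg_right ((hb a ha t ht).trans ?_) (norm_nonneg _)
    exact mul_le_mul_of_nonneg_left
      (Real.exp_le_exp.2 (mul_le_mul_of_nonneg_right (hΛ a ha) ht)) (hC a).le
  rw [← Finset.sum_mul] at h1
  exact h1.trans (mul_le_mul_of_nonneg_right (by linarith) (Real.exp_pos _).le)

variable [CompleteSpace E]

theorem continuousOn_mixedOp (h : OrderDecomposition V P A) (φ : E) :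
    ContinuousOn (fun t => mixedOp V P A t φ) (Ici 0) := by
  simp only [mixedOp, _root_.sum_apply]
  refine continuousOn_finsetSum _ fun a ha => ?_
  exact (continuousOn_mlOp (h.pos a ha) le_rfl A).clm_apply continuousOn_const

/-- `P a` commutes with `A`, hence with the series in `A`, so the family is block diagonal with one
constant-order family per block. -/
theorem proj_mixedOp (h : OrderDecomposition V P A) {a : ℝ} (ha : a ∈ V) {t : ℝ} (ht : 0 ≤ t)
    (φ : E) : P a (mixedOp V P A t φ) = mlOp a 0 A t (P a φ) := by
  have h1 : mixedOp V P A t φ = ∑ b ∈ V, P b (mlOp b 0 A t φ) := by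
    rw [mixedOp, _root_.sum_apply]
    refine Finset.sum_congr rfl fun b hb => ?_
    rw [← (commute_mlOp (h.pos b hb) le_rfl ht (h.comm b hb)).eq]
    rfl
  rw [h1, h.proj_sum ha fun b => mlOp b 0 A t φ]
  exact congrArg (fun B : E →L[ℝ] E => B φ)
    (commute_mlOp (h.pos a ha) le_rfl ht (h.comm a ha)).eq

theorem proj_mixedInt (h : OrderDecomposition V P A) {a : ℝ} (ha : a ∈ V) {t : ℝ} (ht : 0 ≤ t)
    {v : ℝ → E} (hv : ContinuousOn v (Ici 0)) :
    P a (mixedInt V P v t) = fracInt (1 - a) (fun s => P a (v s)) t := by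
  rw [mixedInt, h.proj_sum ha fun b => fracInt (1 - b) v t,
    fracInt_clm (sub_nonneg.2 (h.le_one a ha)) ht hv]

theorem mixedInt_mixedOp (h : OrderDecomposition V P A) {t : ℝ} (ht : 0 ≤ t) (φ : E) :
    mixedInt V P (fun s => mixedOp V P A s φ - mixedOp V P A 0 φ) t =
      ∫ s in (0 : ℝ)..t, A (mixedOp V P A s φ) := by
  have hc := h.continuousOn_mixedOp φ
  have hi := intervalIntegrable_of_continuousOn_Ici (hc.const_clm_apply A) ht
  rw [← h.sum_apply (∫ s in (0 : ℝ)..t, A (mixedOp V P A s φ)), mixedInt]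
  refine Finset.sum_congr rfl fun a ha => ?_
  rw [← ContinuousLinearMap.intervalIntegral_comp_comm _ hi,
    ← fracInt_clm (sub_nonneg.2 (h.le_one a ha)) ht (hc.sub_vector _)]
  have h1 : ∀ s, 0 ≤ s → P a (mixedOp V P A s φ - mixedOp V P A 0 φ) =
      mlOp a 0 A s (P a φ) - mlOp a 0 A 0 (P a φ) := fun s hs => by
    rw [map_sub, h.proj_mixedOp ha hs, h.proj_mixedOp ha le_rfl]
  have h2 : ∀ s, 0 ≤ s → P a (A (mixedOp V P A s φ)) = A (mlOp a 0 A s (P a φ)) :=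
    fun s hs => by
      rw [← h.proj_mixedOp ha hs]
      exact congrArg (fun B : E →L[ℝ] E => B (mixedOp V P A s φ)) (h.comm a ha).eq
  rw [fracInt_congr ht h1, integral_congr_Ici ht h2,
    fracInt_mlOp (h.pos a ha) (h.le_one a ha) ht]

/-- `G` and the primitive of `A u` have the same one-sided derivative. Both vanish at 0, also for
order `1 - a = 0`, because `u 0` has been subtracted. -/
theorem mixedInt_eq_integral {u G : ℝ → E} (hu : ContinuousOn u (Ici 0))
    (hG : ∀ t, 0 ≤ t → G t = mixedInt V P (fun s => u s - u 0) t)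
    (hd : ∀ t, 0 ≤ t → HasDerivWithinAt G (A (u t)) (Ici 0) t) {t : ℝ} (ht : 0 ≤ t) :
    mixedInt V P (fun s => u s - u 0) t = ∫ s in (0 : ℝ)..t, A (u s) := by
  have h1 : ∀ s, 0 ≤ s →
      HasDerivWithinAt (fun t => G t - ∫ s in (0 : ℝ)..t, A (u s)) 0 (Ici 0) s := fun s hs => by
    have := (hd s hs).sub (hasDerivWithinAt_integral_Ici (hu.const_clm_apply A) hs)
    rw [sub_self] at this
    exact this
  have h2 := constant_of_has_deriv_right_zero (a := 0) (b := t)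
    (fun s hs => ((h1 s hs.1).continuousWithinAt).mono Icc_subset_Ici_self)
    (fun s hs => (h1 s hs.1).mono (Ici_subset_Ici.2 hs.1)) t ⟨ht, le_rfl⟩
  have h3 : G 0 = 0 := by
    rw [hG 0 le_rfl, mixedInt]
    refine Finset.sum_eq_zero fun a _ => ?_
    unfold fracInt
    split_ifs <;> simp
  rw [h3] at h2
  rw [← hG t ht]
  simpa [sub_eq_zero] using h2

/-- Each `P a` sends the difference from the explicit solution to a solution of the homogeneous
equation of constant order `a`, which is zero. -/
theorem eq_mixedOp (h : OrderDecomposition V P A) {u : ℝ → E} (hu : ContinuousOn u (Ici 0))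
    (hint : ∀ t, 0 ≤ t →
      mixedInt V P (fun s => u s - u 0) t = ∫ s in (0 : ℝ)..t, A (u s)) {t : ℝ} (ht : 0 ≤ t) :
    u t = mixedOp V P A t (u 0) := by
  set z : ℝ → E := fun s => mixedOp V P A s (u 0)
  have hzc : ContinuousOn z (Ici 0) := h.continuousOn_mixedOp (u 0)
  have hz0 : z 0 = u 0 := h.mixedOp_zero (u 0)
  rw [← sub_eq_zero, ← h.sum_apply (u t - mixedOp V P A t (u 0))]
  refine Finset.sum_eq_zero fun a ha => ?_
  have hβ : 0 ≤ 1 - a := sub_nonneg.2 (h.le_one a ha)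
  have key : ∀ v : ℝ → E, ContinuousOn v (Ici 0) →
      (∀ t, 0 ≤ t → mixedInt V P (fun s => v s - v 0) t = ∫ s in (0 : ℝ)..t, A (v s)) →
      ∀ t, 0 ≤ t → fracInt (1 - a) (fun s => P a (v s - v 0)) t =
        ∫ s in (0 : ℝ)..t, A (P a (v s)) := fun v hv hvi t ht => by
    rw [← h.proj_mixedInt ha ht (hv.sub_vector _), hvi t ht,
      ← ContinuousLinearMap.intervalIntegral_comp_comm _
        (intervalIntegrable_of_continuousOn_Ici (hv.const_clm_apply A) ht)]
    exact integral_congr_Ici ht fun s _ =>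
      congrArg (fun B : E →L[ℝ] E => B (v s)) (h.comm a ha).eq
  have hPu : ContinuousOn (fun s => P a (u s)) (Ici 0) := hu.const_clm_apply (P a)
  have hPz : ContinuousOn (fun s => P a (z s)) (Ici 0) := hzc.const_clm_apply (P a)
  refine eq_zero_of_fracInt_eq_integral (v := fun s => P a (u s - mixedOp V P A s (u 0)))
    (h.pos a ha) (h.le_one a ha) A ((P a).continuous.comp_continuousOn (hu.sub hzc))
    (fun t ht => ?_) ht
  have h1 := key u hu hint t ht
  have h2 := key z hzc (fun t ht => h.mixedInt_mixedOp ht (u 0)) t ht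
  have h3 : ∀ s, 0 ≤ s → P a (u s - mixedOp V P A s (u 0)) =
      P a (u s - u 0) - P a (z s - z 0) := fun s _ => by
    rw [hz0, ← map_sub, sub_sub_sub_cancel_right]
  have h4 : ∀ s, 0 ≤ s → A (P a (u s - mixedOp V P A s (u 0))) =
      A (P a (u s)) - A (P a (z s)) := fun s _ => by rw [map_sub, map_sub]
  rw [fracInt_congr ht h3, fracInt_sub hβ ht
    ((hu.sub_vector _).const_clm_apply (P a))
    ((hzc.sub_vector _).const_clm_apply (P a)), h1, h2,
    integral_congr_Ici ht h4, intervalIntegral.integral_sub]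
  · exact intervalIntegrable_of_continuousOn_Ici (hPu.const_clm_apply A) ht
  · exact intervalIntegrable_of_continuousOn_Ici (hPz.const_clm_apply A) ht

end OrderDecomposition

end

/-! ### Pointwise representatives in L^p -/

section

variable {X : Type*} [MeasurableSpace X] {μ : Measure X} {p : ℝ≥0∞} [Fact (1 ≤ p)]

/-- Multiplication by the indicator function of a measurable set on `L^p`. -/
noncomputable def indicatorCLM (μ : Measure X) (p : ℝ≥0∞) [Fact (1 ≤ p)] {s : Set X}
    (hs : MeasurableSet s) : Lp ℝ p μ →L[ℝ] Lp ℝ p μ :=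
  LinearMap.mkContinuous
    { toFun := fun f => ((Lp.memLp f).indicator hs).toLp _
      map_add' := fun f g => by
        apply Lp.ext
        filter_upwards [((Lp.memLp (f + g)).indicator hs).coeFn_toLp,
          ((Lp.memLp f).indicator hs).coeFn_toLp, ((Lp.memLp g).indicator hs).coeFn_toLp,
          Lp.coeFn_add f g, Lp.coeFn_add (((Lp.memLp f).indicator hs).toLp _)
            (((Lp.memLp g).indicator hs).toLp _)] with x h1 h2 h3 h4 h5
        rw [h1, h5, Pi.add_apply, h2, h3]
        by_cases hx : x ∈ s
        · simp only [indicator_of_mem hx, h4, Pi.add_apply]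
        · simp [hx]
      map_smul' := fun c f => by
        apply Lp.ext
        filter_upwards [((Lp.memLp (c • f)).indicator hs).coeFn_toLp,
          ((Lp.memLp f).indicator hs).coeFn_toLp,
          Lp.coeFn_smul c f, Lp.coeFn_smul c (((Lp.memLp f).indicator hs).toLp _)]
          with x h1 h2 h4 h5
        rw [h1, RingHom.id_apply, h5, Pi.smul_apply, h2]
        by_cases hx : x ∈ s
        · simp only [indicator_of_mem hx, h4, Pi.smul_apply]
        · simp [hx] }
    1 fun f => by
      rw [one_mul]
      refine Lp.norm_le_norm_of_ae_le ?_
      filter_upwards [((Lp.memLp f).indicator hs).coeFn_toLp] with x h1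
      simp only [LinearMap.coe_mk, AddHom.coe_mk]
      rw [h1]
      exact norm_indicator_le_norm_self _ _

theorem indicatorCLM_coeFn {s : Set X} (hs : MeasurableSet s) (f : Lp ℝ p μ) :
    indicatorCLM μ p hs f =ᵐ[μ] s.indicator f :=
  ((Lp.memLp f).indicator hs).coeFn_toLp

theorem exists_setIntegral_norm_le {B : Set X} (hB : μ B < ∞) :
    ∃ C : ℝ, ∀ f : Lp ℝ p μ, ∫ x in B, ‖f x‖ ∂μ ≤ C * ‖f‖ := by
  -- The Hölder constant `μ(B)^(1 - 1/p)`. For `p = ∞` the conventions `∞.toReal = 0` and `1 / 0 =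
  -- 0` give the correct exponent 1.
  refine ⟨((μ B) ^ (1 / (1 : ℝ≥0∞).toReal - 1 / p.toReal)).toReal, fun f => ?_⟩
  have hp : 1 ≤ p := Fact.out
  have h0 : 0 ≤ 1 / (1 : ℝ≥0∞).toReal - 1 / p.toReal := by
    rcases eq_or_ne p ∞ with rfl | hp'
    · simp
    · have : 1 ≤ p.toReal := by
        rw [← ENNReal.toReal_one]; exact ENNReal.toReal_mono hp' hp
      have := div_le_one_of_le₀ this (by linarith)
      simpa using this
  have h1 := eLpNorm_le_eLpNorm_mul_rpow_measure_univ (μ := μ.restrict B) hp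
    (Lp.aestronglyMeasurable f).restrict
  have h2 : eLpNorm f p (μ.restrict B) ≤ eLpNorm f p μ :=
    eLpNorm_mono_measure _ Measure.restrict_le_self
  rw [integral_norm_eq_lintegral_enorm (Lp.aestronglyMeasurable f).restrict,
    ← eLpNorm_one_eq_lintegral_enorm, Lp.norm_def, ← ENNReal.toReal_mul, mul_comm]
  refine ENNReal.toReal_mono ?_ (h1.trans ?_)
  · exact ENNReal.mul_ne_top (Lp.eLpNorm_ne_top f) (ENNReal.rpow_ne_top_of_nonneg h0 hB.ne)
  · rw [Measure.restrict_apply_univ]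
    gcongr

/-- Integration over a set of finite measure as a continuous functional on `L^p`. -/
theorem exists_setIntegralCLM {B : Set X} (hB : μ B < ∞) :
    ∃ L : Lp ℝ p μ →L[ℝ] ℝ, ∀ f, L f = ∫ x in B, f x ∂μ := by
  obtain ⟨C, hC⟩ := exists_setIntegral_norm_le (p := p) hB
  have hi : ∀ f : Lp ℝ p μ, IntegrableOn f B μ := fun f =>
    integrableOn_Lp_of_measure_ne_top f Fact.out hB.ne
  refine ⟨LinearMap.mkContinuous
    { toFun := fun f => ∫ x in B, f x ∂μ
      map_add' := fun f g => ?_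
      map_smul' := fun c f => ?_ } C fun f => ?_, fun f => rfl⟩
  · rw [← integral_add (hi f) (hi g)]
    exact integral_congr_ae (ae_restrict_of_ae (Lp.coeFn_add f g))
  · rw [RingHom.id_apply, ← integral_smul]
    exact integral_congr_ae (ae_restrict_of_ae (Lp.coeFn_smul c f))
  · exact (norm_integral_le_integral_norm _).trans (hC f)

/-- The Bochner integral of an `L^p`-valued function is computed pointwise almost everywhere from a
jointly measurable representative. -/
theorem coeFn_integral_ae_eq [SigmaFinite μ] {T : Type*} [MeasurableSpace T] {ν : Measure T}
    [SFinite ν] {v : T → Lp ℝ p μ} (hv : Integrable v ν) {w : T → X → ℝ}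
    (hw : Measurable (Function.uncurry w)) (hvw : ∀ᵐ s ∂ν, v s =ᵐ[μ] w s) :
    (∫ s, v s ∂ν : Lp ℝ p μ) =ᵐ[μ] fun x => ∫ s, w s x ∂ν := by
  have key : ∀ B, MeasurableSet B → μ B < ∞ →
      Integrable (Function.uncurry w) (ν.prod (μ.restrict B)) := by
    intro B _ hB
    obtain ⟨C, hC⟩ := exists_setIntegral_norm_le (p := p) hB
    rw [integrable_prod_iff hw.aestronglyMeasurable]
    constructor
    · filter_upwards [hvw] with s hs
      exact (integrableOn_Lp_of_measure_ne_top (v s) Fact.out hB.ne).congr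
        (ae_restrict_of_ae hs)
    · refine (hv.norm.const_mul C).mono'
        hw.stronglyMeasurable.norm.integral_prod_right'.aestronglyMeasurable ?_
      filter_upwards [hvw] with s hs
      rw [Real.norm_of_nonneg (integral_nonneg fun _ => norm_nonneg _)]
      refine le_trans (le_of_eq ?_) (hC (v s))
      refine integral_congr_ae (ae_restrict_of_ae ?_)
      filter_upwards [hs] with x hx
      rw [hx]; rfl
  -- Compare integrals over sets `B` of finite measure: integration over `B` is a continuous
  -- functional, so it passes through the Bochner integral, and Fubini applies to `w`.
  refine ae_eq_of_forall_setIntegral_eq_of_sigmaFinite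
    (fun B _ hB => integrableOn_Lp_of_measure_ne_top _ Fact.out hB.ne)
    (fun B hBm hB => (key B hBm hB).integral_prod_right) fun B hBm hB => ?_
  obtain ⟨L, hL⟩ := exists_setIntegralCLM (p := p) hB
  rw [← hL, ← ContinuousLinearMap.integral_comp_comm L hv]
  rw [← integral_integral_swap (key B hBm hB)]
  refine integral_congr_ae ?_
  filter_upwards [hvw] with s hs
  rw [hL]
  exact integral_congr_ae (ae_restrict_of_ae hs)

/-- A continuous curve in `L^p` has a jointly measurable representative. -/
theorem exists_measurable_representative {v : ℝ → Lp ℝ p μ} (hv : Continuous v) :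
    ∃ w : ℝ → X → ℝ, Measurable (Function.uncurry w) ∧ ∀ t, v t =ᵐ[μ] w t := by
  classical
  set q := TopologicalSpace.denseSeq ℝ
  have hex : ∀ (n : ℕ) (t : ℝ), ∃ j, ‖v (q j) - v t‖ < (1 / 2) ^ n := fun n t => by
    have ho : IsOpen {s | ‖v s - v t‖ < (1 / 2) ^ n} :=
      isOpen_lt (by fun_prop) continuous_const
    obtain ⟨s, hs, ⟨j, rfl⟩⟩ := (TopologicalSpace.denseRange_denseSeq ℝ).inter_open_nonempty _ ho
      ⟨t, by simp⟩
    exact ⟨j, hs⟩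
  -- The least admissible index depends measurably on `t`, so replacing `t` by the time `q (N n t)`
  -- gives jointly measurable approximations.
  set N : ℕ → ℝ → ℕ := fun n t => Nat.find (hex n t)
  have hN : ∀ n t, ‖v (q (N n t)) - v t‖ < (1 / 2) ^ n := fun n t => Nat.find_spec (hex n t)
  have hNm : ∀ n, Measurable (N n) := fun n => measurable_find _ fun k =>
    (isOpen_lt (by fun_prop) continuous_const).measurableSet
  have hmeas : Measurable fun z : ℕ × X => v (q z.1) z.2 :=
    measurable_from_prod_countable_right fun j => (Lp.stronglyMeasurable (v (q j))).measurable
  set f : ℕ → ℝ × X → ℝ := fun n z => v (q (N (2 * n) z.1)) z.2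
  have hf : ∀ n, StronglyMeasurable (f n) := fun n =>
    (hmeas.comp (((hNm (2 * n)).comp measurable_fst).prodMk measurable_snd)).stronglyMeasurable
  refine ⟨fun t x => Filter.limUnder Filter.atTop fun n => f n (t, x),
    (StronglyMeasurable.limUnder (l := Filter.atTop) hf).measurable, fun t => ?_⟩
  -- Interleaving with the constant `v t` makes the fast Cauchy sequence identify its own limit:
  -- almost everywhere it converges, and the odd terms show that the limit is `v t`.
  set F : ℕ → Lp ℝ p μ := fun n => if Even n then v (q (N n t)) else v t
  have hF : ∀ n, ‖F n - v t‖ < (1 / 2) ^ n := fun n => by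
    simp only [F]
    split_ifs
    · exact hN n t
    · simp
  have hlim := Lp.ae_tendsto_of_cauchy_eLpNorm (μ := μ) (p := p) (f := fun n => ⇑(F n))
    (B := fun n => ENNReal.ofReal (2 * (1 / 2) ^ n)) (fun n => Lp.aestronglyMeasurable _) Fact.out
    ((summable_geometric_two.mul_left 2).tsum_ofReal_ne_top) (fun K n m hn hm => by
      rw [← Lp.edist_def, edist_dist, ENNReal.ofReal_lt_ofReal_iff (by positivity), dist_eq_norm,
        ← sub_sub_sub_cancel_right _ _ (v t)]
      have h1 := hF n
      have h2 := hF m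
      have h3 : ((1 : ℝ) / 2) ^ n ≤ (1 / 2) ^ K :=
        pow_le_pow_of_le_one (by norm_num) (by norm_num) hn
      have h4 : ((1 : ℝ) / 2) ^ m ≤ (1 / 2) ^ K :=
        pow_le_pow_of_le_one (by norm_num) (by norm_num) hm
      have h5 := norm_sub_le (F n - v t) (F m - v t)
      linarith)
  filter_upwards [hlim] with x hx
  obtain ⟨l, hl⟩ := hx
  have h1 : Filter.Tendsto (fun n : ℕ => 2 * n) Filter.atTop Filter.atTop :=
    Filter.tendsto_atTop_mono (fun n => by simp only [id]; omega) Filter.tendsto_id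
  have h2 : Filter.Tendsto (fun n : ℕ => 2 * n + 1) Filter.atTop Filter.atTop :=
    Filter.tendsto_atTop_mono (fun n => by simp only [id]; omega) Filter.tendsto_id
  have h3 := hl.comp h1
  have h4 := hl.comp h2
  have h5 : (fun n => F n x) ∘ (fun n : ℕ => 2 * n) = fun n => f n (t, x) := by
    ext n; simp [F, f]
  have h6 : (fun n => F n x) ∘ (fun n : ℕ => 2 * n + 1) = fun _ => v t x := by
    ext n; simp [F]
  rw [h5] at h3
  rw [h6] at h4
  rw [h3.limUnder_eq]
  exact tendsto_nhds_unique tendsto_const_nhds h4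

/-- The fractional integral in `L^p` is computed pointwise from a measurable representative. -/
theorem fracInt_coeFn [SigmaFinite μ] {β t : ℝ} (hβ : 0 ≤ β) (ht : 0 ≤ t) {v : ℝ → Lp ℝ p μ}
    (hv : ContinuousOn v (Ici 0)) {w : ℝ → X → ℝ} (hw : Measurable (Function.uncurry w))
    (hvw : ∀ t, 0 ≤ t → v t =ᵐ[μ] w t) :
    ⇑(fracInt β v t) =ᵐ[μ] rlIntegral (fun _ => β) w t := by
  unfold fracInt rlIntegral
  split_ifs with h
  · filter_upwards [hvw t ht] with x hx
    simp [hx]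
  · have hi := intervalIntegrable_sub_rpow_smul (lt_of_le_of_ne hβ (Ne.symm h)) ht hv
    rw [intervalIntegrable_iff_integrableOn_Ioc_of_le ht] at hi
    rw [intervalIntegral.integral_of_le ht]
    have h1 := coeFn_integral_ae_eq (w := fun s x => (t - s) ^ (β - 1) * w s x) hi
      (by
        have h2 : Measurable fun z : ℝ × X => (t - z.1) ^ (β - 1) := by fun_prop
        exact h2.mul hw)
      (by
        filter_upwards [ae_restrict_mem measurableSet_Ioc] with s hs
        filter_upwards [hvw s hs.1.le, Lp.coeFn_smul ((t - s) ^ (β - 1)) (v s)] with x hx hx'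
        rw [hx', Pi.smul_apply, hx, smul_eq_mul])
    filter_upwards [h1, Lp.coeFn_smul (1 / Real.Gamma β)
      (∫ s in Ioc 0 t, (t - s) ^ (β - 1) • v s)] with x hx hx'
    rw [hx', Pi.smul_apply, hx, smul_eq_mul, intervalIntegral.integral_of_le ht]

end

/-! ### Isolating a single projection -/

/-- If `A` commutes with `∑ s^a / Γ(a + 1) P a` for all `s ≥ 0`, it commutes with every `P a`. -/
theorem commute_of_commute_sum_rpow {R : Type*} [Ring R] [Algebra ℝ R] {V : Finset ℝ}
    (hV : ∀ a ∈ V, 0 < a) {P : ℝ → R} {A : R}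
    (h : ∀ s : ℝ, 0 ≤ s → Commute (∑ a ∈ V, (s ^ a / Real.Gamma (a + 1)) • P a) A) {b : ℝ}
    (hb : b ∈ V) : Commute (P b) A := by
  classical
  -- At `s = e^k` the coefficient `s^a` is `(e^a)^k`. Combining these values of `s` with the
  -- coefficients of `Q` produces `Q(e^a)`, which is 1 for `a = b` and 0 at the other nodes.
  set Q := Lagrange.basis V Real.exp b
  have hG : Real.Gamma (b + 1) ≠ 0 := (Real.Gamma_pos_of_pos (by linarith [hV b hb])).ne'
  have h1 : ∑ k ∈ Finset.range (Q.natDegree + 1),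
      Q.coeff k • ∑ a ∈ V, (Real.exp k ^ a / Real.Gamma (a + 1)) • P a =
        (1 / Real.Gamma (b + 1)) • P b := by
    simp_rw [Finset.smul_sum]
    rw [Finset.sum_comm, Finset.sum_eq_single b]
    · simp_rw [smul_smul]
      rw [← Finset.sum_smul]
      congr 1
      rw [← Lagrange.eval_basis_self Real.exp_injective.injOn hb, Polynomial.eval_eq_sum_range,
        Finset.sum_div]
      refine Finset.sum_congr rfl fun k _ => ?_
      rw [← Real.exp_mul, mul_comm (k : ℝ) b, Real.exp_mul, Real.rpow_natCast, mul_div_assoc]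
    · intro a ha hab
      simp_rw [smul_smul]
      rw [← Finset.sum_smul]
      have h2 : ∑ k ∈ Finset.range (Q.natDegree + 1),
          Q.coeff k * (Real.exp k ^ a / Real.Gamma (a + 1)) = 0 := by
        rw [← zero_div (Real.Gamma (a + 1)), ← Lagrange.eval_basis_of_ne (v := Real.exp) hab.symm ha,
          Polynomial.eval_eq_sum_range, Finset.sum_div]
        refine Finset.sum_congr rfl fun k _ => ?_
        rw [← Real.exp_mul, mul_comm (k : ℝ) a, Real.exp_mul, Real.rpow_natCast, mul_div_assoc]
      rw [h2, zero_smul]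
    · exact fun hb' => absurd hb hb'
  have h3 : Commute ((1 / Real.Gamma (b + 1)) • P b) A := by
    rw [← h1]
    exact Commute.sum_left _ _ _ fun k _ => (h _ (Real.exp_pos _).le).smul_left _
  have h4 := h3.smul_left (Real.Gamma (b + 1))
  rwa [smul_smul, mul_one_div_cancel hG, one_smul] at h4

/-! ### Level sets of the order -/

section

variable {X : Type*} [MeasurableSpace X] {μ : Measure X} {p : ℝ≥0∞} [Fact (1 ≤ p)]

/-- The projection of `L^p` onto the functions supported on the level set `{γ = a}`. -/
noncomputable def levelProj (μ : Measure X) (p : ℝ≥0∞) [Fact (1 ≤ p)] {γ : X → ℝ}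
    (hγ : Measurable γ) (a : ℝ) : Lp ℝ p μ →L[ℝ] Lp ℝ p μ :=
  indicatorCLM μ p (hγ (measurableSet_singleton a))

theorem levelProj_coeFn {γ : X → ℝ} (hγ : Measurable γ) (a : ℝ) (f : Lp ℝ p μ) :
    levelProj μ p hγ a f =ᵐ[μ] fun x => if γ x = a then f x else 0 := by
  classical
  filter_upwards [indicatorCLM_coeFn (hγ (measurableSet_singleton a)) f] with x hx
  rw [levelProj, hx, indicator_apply]
  congr

/-- At almost every point exactly one level set contributes. This lets a finite sum of
constant-order objects stand for a variable-order one. -/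
theorem coeFn_sum_levelProj {γ : X → ℝ} (hγ : Measurable γ) {V : Finset ℝ}
    (hV : ∀ᵐ x ∂μ, γ x ∈ V) (F : ℝ → Lp ℝ p μ) :
    ∀ᵐ x ∂μ, (∑ a ∈ V, levelProj μ p hγ a (F a) : Lp ℝ p μ) x = F (γ x) x := by
  classical
  have h1 : ∀ W : Finset ℝ, ∀ᵐ x ∂μ, (∑ a ∈ W, levelProj μ p hγ a (F a) : Lp ℝ p μ) x =
      ∑ a ∈ W, levelProj μ p hγ a (F a) x := fun W => by
    induction W using Finset.induction_on with
    | empty =>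
      filter_upwards [Lp.coeFn_zero ℝ p μ] with x hx
      simpa using hx
    | insert b W hb ih =>
      rw [Finset.sum_insert hb]
      filter_upwards [ih, Lp.coeFn_add (levelProj μ p hγ b (F b))
        (∑ a ∈ W, levelProj μ p hγ a (F a))] with x hx hx'
      rw [hx', Pi.add_apply, hx, Finset.sum_insert hb]
  have h2 : ∀ᵐ x ∂μ, ∀ a ∈ V, levelProj μ p hγ a (F a) x = if γ x = a then F a x else 0 :=
    (Finset.eventually_all V).2 fun a _ => levelProj_coeFn hγ a (F a)
  filter_upwards [h1 V, h2, hV] with x hx1 hx2 hx3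
  rw [hx1, Finset.sum_congr rfl hx2, Finset.sum_ite_eq V (γ x) fun a => F a x, if_pos hx3]

theorem orderDecomposition_levelProj {γ : X → ℝ} (hγ : Measurable γ) {V : Finset ℝ}
    (hV : ∀ᵐ x ∂μ, γ x ∈ V) (hpos : ∀ a ∈ V, 0 < a) (hle : ∀ a ∈ V, a ≤ 1)
    {A : Lp ℝ p μ →L[ℝ] Lp ℝ p μ}
    (hA : ∀ φ : Lp ℝ p μ, ∀ s : ℝ, 0 ≤ s → ∀ ψ : Lp ℝ p μ,
      (∀ᵐ x ∂μ, ψ x = s ^ γ x / Real.Gamma (γ x + 1) * φ x) →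
      ∀ᵐ x ∂μ, s ^ γ x / Real.Gamma (γ x + 1) * (A φ) x = (A ψ) x) :
    OrderDecomposition V (levelProj μ p hγ) A where
  pos := hpos
  le_one := hle
  sum_apply φ := Lp.ext (coeFn_sum_levelProj hγ hV fun _ => φ)
  proj a φ := by
    apply Lp.ext
    filter_upwards [levelProj_coeFn hγ a (levelProj μ p hγ a φ), levelProj_coeFn hγ a φ]
      with x h1 h2
    rw [h1, h2]
    split_ifs <;> rfl
  ortho a b φ hab := by
    apply Lp.ext
    filter_upwards [levelProj_coeFn hγ a (levelProj μ p hγ b φ), levelProj_coeFn hγ b φ,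
      Lp.coeFn_zero ℝ p μ] with x h1 h2 h3
    rw [h1, h2, h3]
    split_ifs with h4 h5
    · exact absurd (h4.symm.trans h5) hab
    · rfl
    · rfl
  comm b hb := by
    refine commute_of_commute_sum_rpow hpos (fun s hs => ?_) hb
    -- Multiplication by `s^γ / Γ(γ + 1)` is this finite sum of projections, so `hA` says that the
    -- sum commutes with `A`.
    have hmul : ∀ φ : Lp ℝ p μ, ∀ᵐ x ∂μ,
        (∑ a ∈ V, (s ^ a / Real.Gamma (a + 1)) • levelProj μ p hγ a :
          Lp ℝ p μ →L[ℝ] Lp ℝ p μ) φ x = s ^ γ x / Real.Gamma (γ x + 1) * φ x := fun φ => by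
      have h1 : (∑ a ∈ V, (s ^ a / Real.Gamma (a + 1)) • levelProj μ p hγ a :
          Lp ℝ p μ →L[ℝ] Lp ℝ p μ) φ =
          ∑ a ∈ V, levelProj μ p hγ a ((s ^ a / Real.Gamma (a + 1)) • φ) := by
        rw [_root_.sum_apply]
        exact Finset.sum_congr rfl fun a _ => by rw [map_smul]; rfl
      have h2 : ∀ᵐ x ∂μ, ∀ a ∈ V, ((s ^ a / Real.Gamma (a + 1)) • φ : Lp ℝ p μ) x =
          s ^ a / Real.Gamma (a + 1) * φ x :=
        (Finset.eventually_all V).2 fun a _ => Lp.coeFn_smul (s ^ a / Real.Gamma (a + 1)) φ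
      rw [h1]
      filter_upwards [coeFn_sum_levelProj hγ hV fun a => (s ^ a / Real.Gamma (a + 1)) • φ, h2, hV]
        with x hx1 hx2 hx3
      rw [hx1, hx2 _ hx3]
    refine ContinuousLinearMap.ext fun φ => Lp.ext ?_
    filter_upwards [hmul (A φ), hA φ s hs _ (hmul φ)] with x h1 h2
    exact h1.trans h2

theorem mixedInt_coeFn [SigmaFinite μ] {γ : X → ℝ} (hγ : Measurable γ) {V : Finset ℝ}
    (hV : ∀ᵐ x ∂μ, γ x ∈ V) (hle : ∀ a ∈ V, a ≤ 1) {u : ℝ → Lp ℝ p μ}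
    (hu : ContinuousOn u (Ici 0)) {w : ℝ → X → ℝ} (hw : Measurable (Function.uncurry w))
    (huw : ∀ t, 0 ≤ t → u t =ᵐ[μ] w t) {t : ℝ} (ht : 0 ≤ t) :
    ⇑(mixedInt V (levelProj μ p hγ) (fun s => u s - u 0) t) =ᵐ[μ]
      rlIntegral (fun y => 1 - γ y) (fun s y => w s y - w 0 y) t := by
  have hw' : Measurable (Function.uncurry fun s y => w s y - w 0 y) :=
    hw.sub ((hw.comp measurable_prodMk_left).comp measurable_snd)
  have huw' : ∀ t, 0 ≤ t → ⇑(u t - u 0) =ᵐ[μ] fun y => w t y - w 0 y := fun t ht => by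
    filter_upwards [huw t ht, huw 0 le_rfl, Lp.coeFn_sub (u t) (u 0)] with x h1 h2 h3
    rw [h3, Pi.sub_apply, h1, h2]
  have h1 : ∀ᵐ x ∂μ, ∀ a ∈ V, fracInt (1 - a) (fun s => u s - u 0) t x =
      rlIntegral (fun _ => 1 - a) (fun s y => w s y - w 0 y) t x :=
    (Finset.eventually_all V).2 fun a ha =>
      fracInt_coeFn (sub_nonneg.2 (hle a ha)) ht (hu.sub_vector _) hw' huw'
  filter_upwards [coeFn_sum_levelProj hγ hV fun a => fracInt (1 - a) (fun s => u s - u 0) t, h1,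
    hV] with x hx1 hx2 hx3
  rw [mixedInt, hx1, hx2 _ hx3]
  rfl

end

/-! ### The Cauchy problem -/

theorem theorem3p5 {n : ℕ} (Ω : Set (EuclideanSpace ℝ (Fin n))) (hΩ : IsOpen Ω)
    (p : ENNReal) [Fact (1 ≤ p)]
    (A : LpOn Ω p →L[ℝ] LpOn Ω p)
    (α : EuclideanSpace ℝ (Fin n) → ℝ) (hα : AEMeasurable α (volume.restrict Ω))
    (hcomm : CommutesWithOrder α A)
    (m : ℕ) (hm : 1 ≤ m)
    (Ωj : Fin m → Set (EuclideanSpace ℝ (Fin n))) (hcover : ⋃ j, Ωj j = Ω)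
    (αj : Fin m → ℝ) (hαj : ∀ j, αj j ∈ Ioc (0 : ℝ) 1)
    (hval : ∀ j, ∀ x ∈ Ωj j, α x = αj j) :
    ∃ S : ℝ → (LpOn Ω p →L[ℝ] LpOn Ω p),
      IsSolutionOperatorFamily α A S ∧
      ∃ M : ℝ, 0 < M ∧
        ∀ t : ℝ, 0 ≤ t → ‖S t‖ ≤ M * Real.exp ((⨆ j, ‖A‖ ^ (1 / αj j)) * t) := by
  classical
  set μ := (volume : Measure (EuclideanSpace ℝ (Fin n))).restrict Ω
  set γ := hα.mk α
  have hγ : Measurable γ := hα.measurable_mk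
  have hαγ : α =ᵐ[μ] γ := hα.ae_eq_mk
  -- Level sets of the measurable version `γ` replace the `Ωj`, which may overlap, be nonmeasurable
  -- or share a value; the image merges repeated orders.
  set V : Finset ℝ := Finset.univ.image αj
  have hV : ∀ᵐ x ∂μ, γ x ∈ V := by
    filter_upwards [hαγ, ae_restrict_mem hΩ.measurableSet] with x hx hxΩ
    rw [← hcover] at hxΩ
    obtain ⟨j, hj⟩ := mem_iUnion.1 hxΩ
    rw [← hx, hval j x hj]
    exact Finset.mem_image_of_mem _ (Finset.mem_univ j)
  have hVmem : ∀ a ∈ V, ∃ j, αj j = a := fun a ha => by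
    obtain ⟨j, _, hj⟩ := Finset.mem_image.1 ha
    exact ⟨j, hj⟩
  have hpos : ∀ a ∈ V, 0 < a := fun a ha => by
    obtain ⟨j, rfl⟩ := hVmem a ha
    exact (hαj j).1
  have hle : ∀ a ∈ V, a ≤ 1 := fun a ha => by
    obtain ⟨j, rfl⟩ := hVmem a ha
    exact (hαj j).2
  have hD : OrderDecomposition V (levelProj μ p hγ) A :=
    orderDecomposition_levelProj hγ hV hpos hle fun φ s hs ψ hψ => by
      have h1 := hcomm φ s hs ψ (by
        filter_upwards [hψ, hαγ] with x hx hx'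
        rw [hx, hx'])
      filter_upwards [h1, hαγ] with x hx hx'
      rw [← hx, hx']
  have hrl : ∀ (w : ℝ → EuclideanSpace ℝ (Fin n) → ℝ) (t : ℝ),
      rlIntegral (fun y => 1 - γ y) w t =ᵐ[μ] rlIntegral (fun y => 1 - α y) w t := fun w t => by
    filter_upwards [hαγ] with x hx
    simp only [rlIntegral, hx]
  refine ⟨mixedOp V (levelProj μ p hγ) A, fun φ => ⟨?_, fun u hu t ht => ?_⟩,
    hD.exists_norm_mixedOp_le fun a ha => ?_⟩
  · have hc := hD.continuousOn_mixedOp φ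
    refine ⟨hc, ?_, hD.mixedOp_zero φ⟩
    -- The solution is extended to negative times by its value at 0, to be continuous on all of ℝ.
    obtain ⟨w, hw, hrep⟩ := exists_measurable_representative (continuous_comp_max_zero hc)
    have hrep' : ∀ t, 0 ≤ t → mixedOp V (levelProj μ p hγ) A t φ =ᵐ[μ] w t := fun t ht => by
      have := hrep t
      rwa [max_eq_left ht] at this
    refine ⟨w, hw, hrep', fun t => ∫ s in (0 : ℝ)..t, A (mixedOp V (levelProj μ p hγ) A s φ),
      fun t ht => ?_, fun t ht => hasDerivWithinAt_integral_Ici (hc.const_clm_apply A) ht⟩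
    beta_reduce
    rw [← hD.mixedInt_mixedOp ht φ]
    exact (mixedInt_coeFn hγ hV hle hc hw hrep' ht).trans (hrl _ t)
  · obtain ⟨w, hw, hrep, G, hG, hd⟩ := hu.equation
    rw [← hu.initial]
    refine hD.eq_mixedOp hu.continuousOn (fun t ht => ?_) ht
    refine OrderDecomposition.mixedInt_eq_integral (G := G) hu.continuousOn (fun s hs => ?_) hd ht
    exact Lp.ext ((show G s =ᵐ[μ] _ from hG s hs).trans
      ((mixedInt_coeFn hγ hV hle hu.continuousOn hw hrep hs).trans (hrl _ s)).symm)
  · obtain ⟨j, rfl⟩ := hVmem a ha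
    exact le_ciSup (f := fun j => ‖A‖ ^ (1 / αj j)) (finite_range _).bddAbove j
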